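/- A lattice polytope in $\mathbb{R}^d$ is the convex hull of a nonempty finite subset of $\mathbb{Z}^d$, and a lattice polygon is a two-dimensional lattice polytope. A unimodular simplex in $\mathbb{R}^d$ is the convex hull of lattice points $v_0,\dots,v_d\in\mathbb{Z}^d$ such that $v_1-v_0,\dots,v_d-v_0$ is a basis of $\mathbb{Z}^d$. A unimodular cover of a set $P\subset\mathbb{R}^d$ is a collection of unimodular simplices whose union equals $P$. Let $Q_1,Q_2\subset\mathbb{R}^2$ be two lattice polygons, let $k\ge 2$ be an integer, and consider the prismatoid $$P:=\operatorname{conv}\bigl(Q_1\times\{0\}\,\cup\,Q_2\times\{k\}\bigr)\subset\mathbb{R}^3 .$$ If $P\cap(\mathbb{R}^2\times\{1\})$ is a lattice polygon, then $P$ has a unimodular cover. -/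

import Mathlib

/-- The inclusion `ℤᵈ → ℝᵈ`. -/
def latticePoint {d : ℕ} (v : Fin d → ℤ) : Fin d → ℝ := fun i => (v i : ℝ)

/-- A lattice polytope in `ℝᵈ`: the convex hull of a nonempty finite set of points of `ℤᵈ`. -/
def IsLatticePolytope {d : ℕ} (P : Set (Fin d → ℝ)) : Prop :=
  ∃ V : Finset (Fin d → ℤ), V.Nonempty ∧
    P = convexHull ℝ (latticePoint '' (V : Set (Fin d → ℤ)))

/-- A lattice polygon in `ℝᵈ`: a two-dimensional lattice polytope. -/
def IsLatticePolygon {d : ℕ} (P : Set (Fin d → ℝ)) : Prop :=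
  IsLatticePolytope P ∧ Module.finrank ℝ (vectorSpan ℝ P) = 2

/-- The set `Q × {h}` in `ℝ³`, for `Q ⊆ ℝ²`. -/
def atHeight (Q : Set (Fin 2 → ℝ)) (h : ℝ) : Set (Fin 3 → ℝ) :=
  (fun x : Fin 2 → ℝ => ![x 0, x 1, h]) '' Q

/-- The set `conv (Q₁ × {0} ∪ Q₂ × {k})` in `ℝ³`. -/
def prismatoid (Q₁ Q₂ : Set (Fin 2 → ℝ)) (k : ℕ) : Set (Fin 3 → ℝ) :=
  convexHull ℝ (atHeight Q₁ 0 ∪ atHeight Q₂ (k : ℝ))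

/-- A unimodular simplex in `ℝᵈ`: the convex hull of lattice points `v₀, …, v_d` such that the
edge vectors `v₁ - v₀, …, v_d - v₀` form a basis of `ℤᵈ`, that is, have determinant `±1`. -/
def IsUnimodularSimplex {d : ℕ} (T : Set (Fin d → ℝ)) : Prop :=
  ∃ v : Fin (d + 1) → Fin d → ℤ,
    IsUnit (Matrix.of fun i j : Fin d => v i.succ j - v 0 j).det ∧
    T = convexHull ℝ (Set.range fun i => latticePoint (v i))

/-- `P` has a unimodular cover: it is the union of a collection of unimodular simplices. -/
def HasUnimodularCover {d : ℕ} (P : Set (Fin d → ℝ)) : Prop :=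
  ∃ C : Set (Set (Fin d → ℝ)), (∀ T ∈ C, IsUnimodularSimplex T) ∧ ⋃₀ C = P

/-! Write `A`, `B` for the bases and `layer A B (j / k)` for the section at height `j`, that is `(1
- j/k) A + (j/k) B`. A vertex of the section at height 1 divides an edge between a vertex `a` of `A`
and a vertex `b` of `B`. When it is a lattice point `z`, all the points `a + j (z - a)` on that edge
are lattice points, so every integral section is a lattice polygon
(`layer_subset_convexHull_intPoint`). It remains to cover each slab between consecutive sections.

Edges of a Minkowski sum come from edges of its summands, and both weights are positive in an inner
section. Hence every edge direction of any section, with its outer normal, occurs in every inner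
section (`edgesPersist_layer`). As `k ≥ 2`, each slab has an inner section on at least one side.

In a slab between `P` and `Q`, Carathéodory's theorem leaves two kinds of simplices. Cones over a
triangle are refined by subdividing the triangle (`inUnimodularTriangle_of_inTriangle`). Mixed
tetrahedra are spanned by a segment `u` in `P` and a segment `v` in `Q`, and have determinant `±
cross u v`. If its absolute value is at least 2, `exists_intPoint_mem_strip` finds a lattice point
that replaces one segment by a chain of two. The chain gives two mixed tetrahedra of smaller
determinant, and whatever these miss lies in cones over a polygon (`mixed_split`). Induction on the
determinant finishes the slab (`covered_mixed`).

The crux is the existence of that lattice point. Suppose both strips are free, and choose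
coordinates with `u = (1, 0)` and `v = (-a, b)`, `0 < a < b`. Then `(0, 1)` is not in `P`, so `P`
has an upper edge below `(0, 1)` and, by point reflection, a matching lower edge. Both persist in
`Q`, and each forces a horizontal chord of length at least 1, one above and one below the strip of
`Q`. By convexity `Q` has such a chord at level 1, hence a lattice point there, inside the strip
(`not_strip_free`). -/

/-! ### Horizontal chords of planar convex sets -/

/-- If a convex planar set meets two horizontal lines, then it meets every line in between at the
corresponding convex combination. -/
theorem Convex.mk_level_mem {Q : Set (ℝ × ℝ)} (hQ : Convex ℝ Q) {x₁ y₁ x₂ y₂ y : ℝ}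
    (h₁ : (x₁, y₁) ∈ Q) (h₂ : (x₂, y₂) ∈ Q) (h1y : y₁ ≤ y) (hy2 : y ≤ y₂) (hlt : y₁ < y₂) :
    (((y₂ - y) * x₁ + (y - y₁) * x₂) / (y₂ - y₁), y) ∈ Q := by
  have hpos : 0 < y₂ - y₁ := sub_pos.2 hlt
  have := hQ h₁ h₂ (a := (y₂ - y) / (y₂ - y₁)) (b := (y - y₁) / (y₂ - y₁))
    (div_nonneg (by linarith) hpos.le) (div_nonneg (by linarith) hpos.le) (by field_simp; ring)
  convert this using 1
  ext <;> simp <;> field_simp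
  ring

theorem Convex.mk_between_mem {Q : Set (ℝ × ℝ)} (hQ : Convex ℝ Q) {x₁ x x₂ y : ℝ}
    (h₁ : (x₁, y) ∈ Q) (h₂ : (x₂, y) ∈ Q) (h1x : x₁ ≤ x) (hx2 : x ≤ x₂) : (x, y) ∈ Q := by
  rcases eq_or_lt_of_le (h1x.trans hx2) with h | h
  · rwa [le_antisymm h1x (h ▸ hx2)] at h₁
  · have hpos : 0 < x₂ - x₁ := sub_pos.2 h
    have := hQ h₁ h₂ (a := (x₂ - x) / (x₂ - x₁)) (b := (x - x₁) / (x₂ - x₁))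
      (div_nonneg (by linarith) hpos.le) (div_nonneg (by linarith) hpos.le) (by field_simp; ring)
    convert this using 1
    ext <;> simp <;> field_simp <;> ring

/-! ### A convex set with a lattice-free horizontal strip -/

section Strip

variable {Q : Set (ℝ × ℝ)} {a b : ℤ}

/-- A convex set containing `0` and `(-a, b)` without lattice points strictly between the levels
`0` and `b`: its lattice points of nonpositive level lie in a cone. -/
theorem lower_cone_of_strip_free (hQ : Convex ℝ Q) (ha : 0 < a) (hab : a < b)
    (h0 : ((0 : ℝ), (0 : ℝ)) ∈ Q) (hv : ((-a : ℝ), (b : ℝ)) ∈ Q)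
    (hfree : ∀ m n : ℤ, ((m : ℝ), (n : ℝ)) ∈ Q → n ≤ 0 ∨ b ≤ n)
    {m n : ℤ} (hmn : ((m : ℝ), (n : ℝ)) ∈ Q) (hn : n ≤ 0) : 0 ≤ m ∧ m + n ≤ 0 := by
  have ha' : (1 : ℝ) ≤ a := by exact_mod_cast ha
  have hb' : (a : ℝ) + 1 ≤ b := by exact_mod_cast hab
  have hn' : (n : ℝ) ≤ 0 := by exact_mod_cast hn
  have h1 := hQ.mk_level_mem h0 hv (y := 1) (by norm_num) (by linarith) (by linarith)
  have h2 := hQ.mk_level_mem hmn hv (y := 1) (by linarith) (by linarith) (by linarith)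
  have hbn : (0 : ℝ) < b - n := by linarith
  have hb0 : (0 : ℝ) < b - 0 := by linarith
  -- The segment from `0` to `(-a, b)` crosses level 1 at `-a/b`, strictly between `-1` and `0`. If
  -- `(m, n)` left the cone, its segment to `(-a, b)` would cross level 1 beyond `-1` or beyond `0`,
  -- trapping `(-1, 1)` or `(0, 1)` in `Q`; level 1 is inside the strip because `b ≥ 2`.
  constructor
  · by_contra hm
    have hm' : (m : ℝ) ≤ -1 := by exact_mod_cast (by omega : m ≤ -1)
    have := hQ.mk_between_mem (x := ((-1 : ℤ) : ℝ)) h2 h1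
      (by rw [div_le_iff₀ hbn]; push_cast; nlinarith)
      (by rw [le_div_iff₀ hb0]; push_cast; nlinarith)
    have := hfree (-1) 1 (by exact_mod_cast this)
    omega
  · by_contra hm
    have hm' : (1 : ℝ) ≤ m + n := by exact_mod_cast (by omega : 1 ≤ m + n)
    have := hQ.mk_between_mem (x := ((0 : ℤ) : ℝ)) h1 h2
      (by rw [div_le_iff₀ hb0]; push_cast; nlinarith)
      (by rw [le_div_iff₀ hbn]; push_cast; nlinarith)
    have := hfree 0 1 (by exact_mod_cast this)
    omega

theorem Convex.preimage_sub_left {Q : Set (ℝ × ℝ)} (hQ : Convex ℝ Q) (c : ℝ × ℝ) :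
    Convex ℝ {x | c - x ∈ Q} := by
  intro x hx y hy s t hs ht hst
  have := hQ hx hy hs ht hst
  rw [Set.mem_ofPred_eq]
  convert this using 1
  rw [smul_sub, smul_sub, sub_add_sub_comm, ← add_smul, hst, one_smul]

/-- If moreover the set has an upper edge of direction `(d, e)` with `d ≥ 1` and `d + e ≥ 1`, then
it has width at least one at some level above the strip. -/
theorem exists_wide_level_above (hQ : Convex ℝ Q) (ha : 0 < a) (hab : a < b)
    (h0 : ((0 : ℝ), (0 : ℝ)) ∈ Q) (hv : ((-a : ℝ), (b : ℝ)) ∈ Q)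
    (hfree : ∀ m n : ℤ, ((m : ℝ), (n : ℝ)) ∈ Q → n ≤ 0 ∨ b ≤ n)
    {d e m n : ℤ} (hd : 1 ≤ d) (hde : 1 ≤ d + e) (hl : ((m : ℝ), (n : ℝ)) ∈ Q)
    (hr : (((m + d : ℤ) : ℝ), ((n + e : ℤ) : ℝ)) ∈ Q)
    (hmax : d * (b - n) - e * (-a - m) ≤ 0) :
    ∃ x₁ x₂ y : ℝ, (b : ℝ) ≤ y ∧ x₁ + 1 ≤ x₂ ∧ (x₁, y) ∈ Q ∧ (x₂, y) ∈ Q := by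
  -- This applies to both ends of the edge. From a lattice point of the lower cone, a line of
  -- direction `(d, e)` would pass strictly below `(-a, b)`, so the ends lie above the strip. The
  -- reflection `x ↦ (-a, b) - x` preserves the strip and turns the lower cone into a cone with apex
  -- `(-a, b)`.
  have key : ∀ {m n : ℤ}, ((m : ℝ), (n : ℝ)) ∈ Q → d * (b - n) - e * (-a - m) ≤ 0 →
      b ≤ n ∧ m ≤ -a ∧ b - a ≤ m + n := by
    intro m n hmn hmx
    have hbn : b ≤ n := by
      refine (hfree m n hmn).resolve_left fun hn => ?_
      obtain ⟨h1, h2⟩ := lower_cone_of_strip_free hQ ha hab h0 hv hfree hmn hn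
      rcases le_or_gt 0 e with he | he
      · nlinarith [mul_nonneg he (by linarith : 0 ≤ a + m),
          mul_pos (by linarith : 0 < d) (by linarith : 0 < b - n)]
      · nlinarith [mul_nonneg (by linarith : 0 ≤ d + e) (by linarith : 0 ≤ a + m),
          mul_pos (by linarith : 0 < d) (by linarith : 0 < b - n - a - m)]
    refine ⟨hbn, ?_⟩
    have hfree' : ∀ m n : ℤ, ((m : ℝ), (n : ℝ)) ∈ {x : ℝ × ℝ | ((-a : ℝ), (b : ℝ)) - x ∈ Q} →
        n ≤ 0 ∨ b ≤ n := by
      intro m n h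
      have := hfree (-a - m) (b - n) (by push_cast; exact h)
      omega
    obtain ⟨h1, h2⟩ := lower_cone_of_strip_free (hQ.preimage_sub_left ((-a : ℝ), (b : ℝ))) ha hab
      (by simpa using hv)
      (by rw [Set.mem_ofPred_eq, sub_self]; exact h0) hfree' (m := -a - m) (n := b - n)
      (by simpa using hmn) (by omega)
    omega
  obtain ⟨hn, hm, hmn⟩ := key hl hmax
  obtain ⟨hn', hm', hmn'⟩ := key hr (by linarith)
  have ha' : (1 : ℝ) ≤ a := by exact_mod_cast ha
  have hb' : (a : ℝ) + 1 ≤ b := by exact_mod_cast hab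
  have hd' : (1 : ℝ) ≤ d := by exact_mod_cast hd
  have hde' : (1 : ℝ) ≤ d + e := by exact_mod_cast hde
  have e1 : (b : ℝ) ≤ n := by exact_mod_cast hn
  have e2 : (m : ℝ) ≤ -a := by exact_mod_cast hm
  have e3 : (b : ℝ) - a ≤ m + n := by exact_mod_cast hmn
  have e1' : (b : ℝ) ≤ n + e := by exact_mod_cast hn'
  have e2' : (m : ℝ) + d ≤ -a := by exact_mod_cast hm'
  push_cast at hr
  -- The triangle formed by `0` and the edge is cut at the level of the lower end of the edge; the
  -- cone inequalities bound the width of this cut below by 1.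
  rcases le_or_gt 0 e with he | he
  · have he' : (0 : ℝ) ≤ e := by exact_mod_cast he
    refine ⟨_, _, n, e1, ?_, hl,
      hQ.mk_level_mem h0 hr (y := n) (by linarith) (by linarith) (by linarith)⟩
    rw [le_div_iff₀ (by linarith)]
    nlinarith [mul_nonneg he' (by linarith : (0 : ℝ) ≤ -(m + d))]
  · have he' : (e : ℝ) ≤ 0 := by exact_mod_cast he.le
    refine ⟨_, _, n + e, e1', ?_,
      hQ.mk_level_mem h0 hl (y := n + e) (by linarith) (by linarith) (by linarith), hr⟩
    rw [← le_sub_iff_add_le, div_le_iff₀ (by linarith)]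
    nlinarith [mul_nonneg (by linarith : (0 : ℝ) ≤ -e) (by linarith : (0 : ℝ) ≤ m + n)]

/-- The two edge directions of `exists_wide_level_above`, one above and one below, cannot both
occur. -/
theorem not_strip_free (hQ : Convex ℝ Q) (ha : 0 < a) (hab : a < b)
    (h0 : ((0 : ℝ), (0 : ℝ)) ∈ Q) (hv : ((-a : ℝ), (b : ℝ)) ∈ Q)
    (hfree : ∀ m n : ℤ, ((m : ℝ), (n : ℝ)) ∈ Q → n ≤ 0 ∨ b ≤ n)
    {d e m n : ℤ} (hd : 1 ≤ d) (hde : 1 ≤ d + e) (hl : ((m : ℝ), (n : ℝ)) ∈ Q)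
    (hr : (((m + d : ℤ) : ℝ), ((n + e : ℤ) : ℝ)) ∈ Q)
    (hmax : d * (b - n) - e * (-a - m) ≤ 0)
    {d' e' m' n' : ℤ} (hd' : 1 ≤ d') (hde' : 1 ≤ d' + e') (hr' : ((m' : ℝ), (n' : ℝ)) ∈ Q)
    (hl' : (((m' - d' : ℤ) : ℝ), ((n' - e' : ℤ) : ℝ)) ∈ Q)
    (hmin : d' * n' - e' * m' ≤ 0) : False := by
  obtain ⟨x₁, x₂, y, hy, hx, h1, h2⟩ :=
    exists_wide_level_above hQ ha hab h0 hv hfree hd hde hl hr hmax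
  have hfree' : ∀ m n : ℤ, ((m : ℝ), (n : ℝ)) ∈ {x : ℝ × ℝ | ((-a : ℝ), (b : ℝ)) - x ∈ Q} →
      n ≤ 0 ∨ b ≤ n := by
    intro m n h
    have := hfree (-a - m) (b - n) (by push_cast; exact h)
    omega
  obtain ⟨x₁', x₂', y', hy', hx', h1', h2'⟩ :=
    exists_wide_level_above (hQ.preimage_sub_left ((-a : ℝ), (b : ℝ))) ha hab
      (by simpa using hv)
      (by rw [Set.mem_ofPred_eq, sub_self]; exact h0) hfree' hd' hde' (m := -a - m') (n := b - n')
      (by simpa using hr')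
      (by
        push_cast at hl' ⊢
        rw [Set.mem_ofPred_eq]
        convert hl' using 1
        ext <;> simp <;> ring)
      (by linarith)
  have ha' : (1 : ℝ) ≤ a := by exact_mod_cast ha
  have hb' : (a : ℝ) + 1 ≤ b := by exact_mod_cast hab
  -- Level 1 lies between the wide levels `b - y' ≤ 0` and `y ≥ b`, and chord length is concave in
  -- the level, so the chord at level 1 also has length at least 1 and contains an integer abscissa.
  have h3 := hQ.mk_level_mem (y := 1) (h2' : (-(a : ℝ) - x₂', (b : ℝ) - y') ∈ Q) h1
    (by linarith) (by linarith) (by linarith)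
  have h4 := hQ.mk_level_mem (y := 1) (h1' : (-(a : ℝ) - x₁', (b : ℝ) - y') ∈ Q) h2
    (by linarith) (by linarith) (by linarith)
  set z := ((y - 1) * (-(a : ℝ) - x₂') + (1 - (b - y')) * x₁) / (y - (b - y')) with hz
  have hpos : (0 : ℝ) < y - (b - y') := by linarith
  have hle : z + 1 ≤ ((y - 1) * (-(a : ℝ) - x₁') + (1 - (b - y')) * x₂) / (y - (b - y')) := by
    rw [hz, le_div_iff₀ hpos, add_mul, div_mul_cancel₀ _ hpos.ne']
    nlinarith [mul_le_mul_of_nonneg_left hx' (by linarith : 0 ≤ y - 1),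
      mul_le_mul_of_nonneg_left hx (by linarith : 0 ≤ 1 - (b - y'))]
  have := hfree ⌈z⌉ 1 (by
    push_cast
    exact hQ.mk_between_mem h3 h4 (Int.le_ceil z) ((Int.ceil_lt_add_one z).le.trans hle))
  omega

end Strip

/-! ### The upper edge of `P` across its free strip -/

/-- The height above `s` of the line through the points `p` and `q`. -/
noncomputable def lineHeight (s : ℝ) (p q : ℝ × ℝ) : ℝ :=
  p.2 + (s - p.1) * ((q.2 - p.2) / (q.1 - p.1))

theorem lineHeight_comm {s : ℝ} {p q : ℝ × ℝ} (h : p.1 < q.1) :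
    lineHeight s p q = lineHeight s q p := by
  have h1 : q.1 - p.1 ≠ 0 := by linarith
  have h2 : p.1 - q.1 ≠ 0 := by linarith
  unfold lineHeight
  field_simp
  ring

/-- Pivoting at `p` towards a point above the line increases the slope, hence the height to the
right of `p`. With its mirror image `lineHeight_lt_left`, this improves a chord whenever a point
lies above it. -/
theorem lineHeight_lt_right {s : ℝ} {p q x : ℝ × ℝ} (hp : p.1 < s) (hq : s < q.1) (hx : s < x.1)
    (h : 0 < (q.1 - p.1) * (x.2 - p.2) - (q.2 - p.2) * (x.1 - p.1)) :
    lineHeight s p q < lineHeight s p x := by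
  unfold lineHeight
  have : (q.2 - p.2) / (q.1 - p.1) < (x.2 - p.2) / (x.1 - p.1) := by
    rw [div_lt_div_iff₀ (by linarith) (by linarith)]
    linarith
  nlinarith [mul_lt_mul_of_pos_left this (sub_pos.2 hp)]

theorem lineHeight_lt_left {s : ℝ} {p q x : ℝ × ℝ} (hp : p.1 < s) (hq : s < q.1) (hx : x.1 < s)
    (h : 0 < (q.1 - p.1) * (x.2 - p.2) - (q.2 - p.2) * (x.1 - p.1)) :
    lineHeight s p q < lineHeight s x q := by
  rw [lineHeight_comm (hp.trans hq), lineHeight_comm (hx.trans hq)]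
  unfold lineHeight
  have : (x.2 - q.2) / (x.1 - q.1) < (p.2 - q.2) / (p.1 - q.1) := by
    rw [← neg_div_neg_eq, ← neg_div_neg_eq (p.2 - q.2),
      div_lt_div_iff₀ (by linarith) (by linarith)]
    linarith
  nlinarith [mul_lt_mul_of_pos_left this (sub_pos.2 hq)]

/-- A convex set containing `0` and `(1, 0)`, with finitely many lattice points, none of them in
the open strip spanned by `0` and `(1, 0)` in the direction `(-a, b)`, has an upper edge which
passes below `(0, 1)`. -/
theorem exists_upper_edge {P : Set (ℝ × ℝ)} {a b : ℤ} (hP : Convex ℝ P)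
    (hfin : {z : ℤ × ℤ | ((z.1 : ℝ), (z.2 : ℝ)) ∈ P}.Finite) (ha : 0 < a) (hab : a < b)
    (h0 : ((0 : ℝ), (0 : ℝ)) ∈ P) (hu : ((1 : ℝ), (0 : ℝ)) ∈ P)
    (hfree : ∀ m n : ℤ, ((m : ℝ), (n : ℝ)) ∈ P → b * m + a * n ≤ 0 ∨ b ≤ b * m + a * n) :
    ∃ m n d e : ℤ, 1 ≤ d ∧ 1 ≤ d + e ∧ IsCoprime d e ∧ ((m : ℝ), (n : ℝ)) ∈ P ∧
      (((m + d : ℤ) : ℝ), ((n + e : ℤ) : ℝ)) ∈ P ∧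
      ∀ x y : ℤ, ((x : ℝ), (y : ℝ)) ∈ P → d * (y - n) - e * (x - m) ≤ 0 := by
  classical
  have haR : (0 : ℝ) < a := by exact_mod_cast ha
  have habR : (a : ℝ) < b := by exact_mod_cast hab
  -- In these coordinates the strip is vertical, between abscissas `0` and `b`, and `(0, 1)` becomes
  -- `(a, 1)`. The map has determinant `b > 0`, so it preserves the sign of `cross`.
  let A : ℤ × ℤ → ℝ × ℝ := fun z => ((b * z.1 + a * z.2 : ℤ), (z.2 : ℝ))
  let V := hfin.toFinset
  have hV : ∀ z : ℤ × ℤ, z ∈ V ↔ ((z.1 : ℝ), (z.2 : ℝ)) ∈ P := fun z => by simp [V]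
  let S := (V.filter fun z => b * z.1 + a * z.2 ≤ 0) ×ˢ (V.filter fun z => b ≤ b * z.1 + a * z.2)
  have hS : ∀ z : (ℤ × ℤ) × (ℤ × ℤ), z ∈ S ↔ (z.1 ∈ V ∧ b * z.1.1 + a * z.1.2 ≤ 0) ∧
      (z.2 ∈ V ∧ b ≤ b * z.2.1 + a * z.2.2) := fun z => by simp [S]
  have hbase : (((0, 0), (1, 0)) : (ℤ × ℤ) × (ℤ × ℤ)) ∈ S := by
    rw [hS, hV, hV]
    refine ⟨⟨by simpa using h0, by simp⟩, ⟨by simpa using hu, by simp⟩⟩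
  -- The edge of the upper hull over the strip is the chord that is highest at abscissa `a`. It is a
  -- supporting chord because every lattice point lies on one side of the strip, so one above the
  -- chord could replace an end.
  obtain ⟨⟨l, r⟩, hlr, hmax⟩ := S.exists_max_image
    (fun z => lineHeight a (A z.1) (A z.2)) ⟨_, hbase⟩
  obtain ⟨⟨hl, hlA⟩, ⟨hr, hrA⟩⟩ := (hS _).1 hlr
  dsimp only at hl hlA hr hrA hmax
  have hlt : ∀ z : ℤ × ℤ, b * z.1 + a * z.2 ≤ 0 → (A z).1 < a := fun z hz => by
    have : ((b * z.1 + a * z.2 : ℤ) : ℝ) ≤ 0 := by exact_mod_cast hz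
    exact this.trans_lt haR
  have hgt : ∀ z : ℤ × ℤ, b ≤ b * z.1 + a * z.2 → (a : ℝ) < (A z).1 := fun z hz => by
    have : (b : ℝ) ≤ ((b * z.1 + a * z.2 : ℤ) : ℝ) := by exact_mod_cast hz
    exact habR.trans_le this
  have hbpos : 0 < b := ha.trans hab
  have hA : ∀ x y z : ℤ × ℤ, ((A y).1 - (A x).1) * ((A z).2 - (A x).2) -
      ((A y).2 - (A x).2) * ((A z).1 - (A x).1) =
      b * ((((y.1 - x.1) * (z.2 - x.2) - (y.2 - x.2) * (z.1 - x.1) : ℤ)) : ℝ) := by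
    intro x y z
    simp only [A]
    push_cast
    ring
  -- The line through `l` and `r` supports `P` from above.
  have hsupp : ∀ x : ℤ × ℤ, x ∈ V →
      (r.1 - l.1) * (x.2 - l.2) - (r.2 - l.2) * (x.1 - l.1) ≤ 0 := by
    intro x hx
    by_contra hpos
    rw [not_le] at hpos
    have hpos' : 0 < ((A r).1 - (A l).1) * ((A x).2 - (A l).2) -
        ((A r).2 - (A l).2) * ((A x).1 - (A l).1) := by
      rw [hA]
      exact mul_pos (by exact_mod_cast hbpos) (by exact_mod_cast hpos)
    rcases hfree x.1 x.2 ((hV x).1 hx) with h | h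
    · exact absurd (hmax (x, r) ((hS _).2 ⟨⟨hx, h⟩, hr, hrA⟩)) (not_le.2
        (lineHeight_lt_left (hlt l hlA) (hgt r hrA) (hlt x h) hpos'))
    · exact absurd (hmax (l, x) ((hS _).2 ⟨⟨hl, hlA⟩, hx, h⟩)) (not_le.2
        (lineHeight_lt_right (hlt l hlA) (hgt r hrA) (hgt x h) hpos'))
  -- The point `(0, 1)` lies strictly above that line.
  have hg : ((0 : ℝ), (1 : ℝ)) ∉ P := fun h => by
    have := hfree 0 1 (by exact_mod_cast h)
    omega
  have hh : lineHeight a (A l) (A r) < 1 := by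
    by_contra hge
    rw [not_lt] at hge
    apply hg
    set t := ((a : ℝ) - (A l).1) / ((A r).1 - (A l).1) with ht
    have hden : 0 < (A r).1 - (A l).1 := by linarith [hlt l hlA, hgt r hrA]
    have ht0 : 0 ≤ t := div_nonneg (by linarith [hlt l hlA]) hden.le
    have ht1 : t ≤ 1 := (div_le_one hden).2 (by linarith [hgt r hrA])
    have hc := hP ((hV l).1 hl) ((hV r).1 hr) (sub_nonneg.2 ht1) ht0 (by ring)
    have htA : (A l).1 + t * ((A r).1 - (A l).1) = a := by
      rw [ht, div_mul_cancel₀ _ hden.ne']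
      ring
    have hh' : lineHeight a (A l) (A r) = l.2 + t * (r.2 - l.2) := by
      simp only [lineHeight, ht, A]
      ring
    set h := lineHeight a (A l) (A r) with hhdef
    have hb0 : (0 : ℝ) < b := by exact_mod_cast hbpos
    have hc' : (((a : ℝ) * (1 - h)) / b, h) ∈ P := by
      convert hc using 1
      refine Prod.ext ?_ ?_
      · simp only [A] at htA
        push_cast at htA
        simp only [Prod.smul_mk, Prod.mk_add_mk, smul_eq_mul]
        rw [div_eq_iff hb0.ne', hh']
        linear_combination -htA
      · simp only [Prod.smul_mk, Prod.mk_add_mk, smul_eq_mul]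
        rw [hh']
        ring
    -- This is the point of the base segment with abscissa `a` in the sheared coordinates. If the
    -- chord reached height 1 there, `(0, 1)` would lie between the two.
    have hab' : ((a : ℝ) / b, (0 : ℝ)) ∈ P := hP.mk_between_mem h0 hu (by positivity)
      ((div_le_one hb0).2 habR.le)
    have := hP.mk_level_mem hab' hc' (y := 1) zero_le_one hge (by linarith)
    convert this using 2
    field_simp
    ring
  have habove : 0 < (r.1 - l.1) * (1 - l.2) - (r.2 - l.2) * (0 - l.1) := by
    have hden : 0 < (A r).1 - (A l).1 := by linarith [hlt l hlA, hgt r hrA]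
    have hb0 : (0 : ℝ) < b := by exact_mod_cast hbpos
    have h1 := hA l r (0, 1)
    have h2 : 0 < ((A r).1 - (A l).1) * (1 - (A l).2) - ((A r).2 - (A l).2) * (a - (A l).1) := by
      unfold lineHeight at hh
      have h3 : ((A r).2 - (A l).2) / ((A r).1 - (A l).1) * ((A r).1 - (A l).1) =
        (A r).2 - (A l).2 := div_mul_cancel₀ _ hden.ne'
      have h4 := mul_lt_mul_of_pos_right hh hden
      rw [add_mul, mul_assoc, h3] at h4
      linarith
    have h3 : A (0, 1) = ((a : ℝ), (1 : ℝ)) := by simp [A]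
    rw [h3] at h1
    rw [h1] at h2
    have := (mul_pos_iff_of_pos_left hb0).1 h2
    exact_mod_cast this
  have hs0 := hsupp (0, 0) ((hV _).2 (by simpa using h0))
  have hs1 := hsupp (1, 0) ((hV _).2 (by simpa using hu))
  dsimp only at hs0 hs1
  -- The line passes strictly below `(0, 1)` but not below `(0, 0)` or `(1, 0)`; comparing the first
  -- point with each of the other two gives the two sign conditions on the direction.
  have hd : 0 < r.1 - l.1 := by linarith
  have hde : 0 < (r.1 - l.1) + (r.2 - l.2) := by linarith
  obtain ⟨g, hgdef⟩ : ∃ g : ℤ, g = (Int.gcd (r.1 - l.1) (r.2 - l.2) : ℤ) := ⟨_, rfl⟩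
  have hgpos : 0 < g := by
    rw [hgdef]
    exact_mod_cast Int.gcd_pos_of_ne_zero_left _ hd.ne'
  obtain ⟨d, hd'⟩ : g ∣ r.1 - l.1 := hgdef ▸ Int.gcd_dvd_left ..
  obtain ⟨e, he'⟩ : g ∣ r.2 - l.2 := hgdef ▸ Int.gcd_dvd_right ..
  rw [hd'] at hd
  rw [hd', he', ← mul_add] at hde
  have hd1 : 0 < d := (mul_pos_iff_of_pos_left hgpos).1 hd
  have hde1 : 0 < d + e := (mul_pos_iff_of_pos_left hgpos).1 hde
  refine ⟨l.1, l.2, d, e, hd1, hde1, ?_, (hV l).1 hl, ?_, fun x y hxy => ?_⟩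
  · rw [Int.isCoprime_iff_gcd_eq_one]
    have h1 := Int.gcd_mul_left g d e
    rw [← hd', ← he'] at h1
    have h2 : (g.natAbs : ℤ) = g := Int.natAbs_of_nonneg hgpos.le
    have h3 : g * (Int.gcd d e : ℤ) = g * 1 := by
      rw [mul_one]
      nth_rw 2 [hgdef]
      rw [h1]
      push_cast
      rw [abs_of_pos hgpos]
    exact_mod_cast mul_left_cancel₀ hgpos.ne' h3
  · have hg1 : (1 : ℝ) ≤ g := by exact_mod_cast hgpos
    have := hP ((hV l).1 hl) ((hV r).1 hr) (a := 1 - 1 / (g : ℝ)) (b := 1 / g)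
      (sub_nonneg.2 ((div_le_one (by linarith)).2 hg1)) (by positivity) (by ring)
    have hr1 : (r.1 : ℝ) = l.1 + g * d := by exact_mod_cast (by linarith : r.1 = l.1 + g * d)
    have hr2 : (r.2 : ℝ) = l.2 + g * e := by exact_mod_cast (by linarith : r.2 = l.2 + g * e)
    convert this using 1
    refine Prod.ext ?_ ?_ <;> simp only [Prod.smul_mk, Prod.mk_add_mk, smul_eq_mul, hr1, hr2] <;>
      push_cast <;> field_simp <;> ring
  · have := hsupp (x, y) ((hV _).2 hxy)
    rw [hd', he'] at this
    have h2 : g * (d * (y - l.2) - e * (x - l.1)) ≤ 0 := by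
      dsimp only at this
      linarith
    exact nonpos_of_mul_nonpos_right h2 hgpos

/-! ### Lattice coordinates and persistence of edges -/

/-- The inclusion of `ℤ × ℤ` into `ℝ × ℝ`. -/
def intPoint (z : ℤ × ℤ) : ℝ × ℝ := ((z.1 : ℝ), (z.2 : ℝ))

@[simp] theorem intPoint_fst (z : ℤ × ℤ) : (intPoint z).1 = z.1 := rfl

@[simp] theorem intPoint_snd (z : ℤ × ℤ) : (intPoint z).2 = z.2 := rfl

theorem intPoint_injective : Function.Injective intPoint := fun x y h => by
  have h1 := congrArg Prod.fst h
  have h2 := congrArg Prod.snd h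
  simp only [intPoint_fst, intPoint_snd, Int.cast_inj] at h1 h2
  exact Prod.ext h1 h2

/-- The determinant of two integral vectors in the plane. -/
def cross (d e : ℤ × ℤ) : ℤ := d.1 * e.2 - d.2 * e.1

/-- Every primitive vector along a boundary edge of `P` also lies along a boundary edge of `Q` with
the same outer normal. -/
def EdgesPersist (P Q : Set (ℝ × ℝ)) : Prop :=
  ∀ p d : ℤ × ℤ, IsCoprime d.1 d.2 → intPoint p ∈ P → intPoint (p + d) ∈ P →
    (∀ x, intPoint x ∈ P → cross d (x - p) ≤ 0) →
    ∃ q, intPoint q ∈ Q ∧ intPoint (q + d) ∈ Q ∧ ∀ x, intPoint x ∈ Q → cross d (x - q) ≤ 0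

/-- The set `K` in the coordinates given by the origin `o` and the basis `u`, `g`. -/
def frameSet (K : Set (ℝ × ℝ)) (o u g : ℤ × ℤ) : Set (ℝ × ℝ) :=
  {x | ((o.1 + x.1 * u.1 + x.2 * g.1 : ℝ), (o.2 + x.1 * u.2 + x.2 * g.2 : ℝ)) ∈ K}

section Frame

variable {K P Q : Set (ℝ × ℝ)} {o o' u g : ℤ × ℤ}

theorem Convex.frameSet (hK : Convex ℝ K) : Convex ℝ (frameSet K o u g) := by
  intro x hx y hy s t hs ht hst
  have := hK hx hy hs ht hst
  unfold _root_.frameSet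
  rw [Set.mem_ofPred_eq]
  convert this using 1
  obtain rfl : t = 1 - s := by linarith
  ext <;> simp <;> ring

theorem intPoint_mem_frameSet {z : ℤ × ℤ} : intPoint z ∈ frameSet K o u g ↔
    intPoint (o.1 + z.1 * u.1 + z.2 * g.1, o.2 + z.1 * u.2 + z.2 * g.2) ∈ K := by
  simp [frameSet, intPoint]

theorem intPoint_mem_iff_frameSet (hug : cross u g = 1) {z : ℤ × ℤ} :
    intPoint z ∈ K ↔ intPoint (cross (z - o) g, cross u (z - o)) ∈ frameSet K o u g := by
  rw [intPoint_mem_frameSet]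
  convert Iff.rfl using 3
  simp only [cross, Prod.fst_sub, Prod.snd_sub] at hug ⊢
  refine Prod.ext ?_ ?_
  · linear_combination (z.1 - o.1) * hug
  · linear_combination (z.2 - o.2) * hug

theorem finite_frameSet (hug : cross u g = 1) (hK : {z | intPoint z ∈ K}.Finite) :
    {z | intPoint z ∈ frameSet K o u g}.Finite := by
  have hinj : Function.Injective fun z : ℤ × ℤ =>
      (o.1 + z.1 * u.1 + z.2 * g.1, o.2 + z.1 * u.2 + z.2 * g.2) := by
    intro x y h
    simp only [Prod.mk.injEq] at h
    obtain ⟨h1, h2⟩ := h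
    simp only [cross] at hug
    refine Prod.ext ?_ ?_
    · linear_combination g.2 * h1 - g.1 * h2 - (x.1 - y.1) * hug
    · linear_combination u.1 * h2 - u.2 * h1 - (x.2 - y.2) * hug
  refine (hK.preimage hinj.injOn).subset fun z hz => ?_
  exact intPoint_mem_frameSet.1 hz

theorem EdgesPersist.frameSet (h : EdgesPersist P Q) (hug : cross u g = 1) :
    EdgesPersist (frameSet P o u g) (frameSet Q o' u g) := by
  intro p d hd hp hpd hmax
  have hug' : u.1 * g.2 - u.2 * g.1 = 1 := hug
  obtain ⟨q, hq, hqd, hqmax⟩ := h (o.1 + p.1 * u.1 + p.2 * g.1, o.2 + p.1 * u.2 + p.2 * g.2)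
    (d.1 * u.1 + d.2 * g.1, d.1 * u.2 + d.2 * g.2)
    (by
      obtain ⟨r, s, hrs⟩ := hd
      refine ⟨r * g.2 - s * u.2, s * u.1 - r * g.1, ?_⟩
      linear_combination hrs + (r * d.1 + s * d.2) * hug')
    (intPoint_mem_frameSet.1 hp)
    (by
      convert intPoint_mem_frameSet.1 hpd using 2
      refine Prod.ext ?_ ?_ <;> simp <;> ring)
    (fun x hx => by
      have := hmax _ ((intPoint_mem_iff_frameSet hug).1 hx)
      simp only [cross, Prod.fst_sub, Prod.snd_sub] at this ⊢
      linear_combination this - (d.1 * p.2 - d.2 * p.1) * hug')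
  refine ⟨_, (intPoint_mem_iff_frameSet hug).1 hq, ?_, fun x hx => ?_⟩
  · convert (intPoint_mem_iff_frameSet (o := o') hug).1 hqd using 2
    simp only [cross, Prod.fst_sub, Prod.snd_sub]
    refine Prod.ext ?_ ?_ <;> simp
    · linear_combination -d.1 * hug'
    · linear_combination -d.2 * hug'
  · have := hqmax _ (intPoint_mem_frameSet.1 hx)
    simp only [cross, Prod.fst_sub, Prod.snd_sub] at this ⊢
    linear_combination this - (d.1 * x.2 - d.2 * x.1) * hug'

end Frame

/-! ### A lattice point in one of the two strips -/

/-- If `u` were a proper multiple of a lattice vector, the first lattice point after `p` on the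
segment would lie in the open strip. -/
theorem isCoprime_of_strip_free {K : Set (ℝ × ℝ)} (hK : Convex ℝ K) {p u v : ℤ × ℤ}
    (hp : intPoint p ∈ K) (hpu : intPoint (p + u) ∈ K) (huv : 0 < cross u v)
    (hfree : ∀ w, intPoint w ∈ K → 0 < cross (w - p) v → cross u v ≤ cross (w - p) v) :
    IsCoprime u.1 u.2 := by
  rw [Int.isCoprime_iff_gcd_eq_one]
  obtain ⟨d, hd⟩ : (Int.gcd u.1 u.2 : ℤ) ∣ u.1 := Int.gcd_dvd_left ..
  obtain ⟨e, he⟩ : (Int.gcd u.1 u.2 : ℤ) ∣ u.2 := Int.gcd_dvd_right ..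
  obtain ⟨n, hn⟩ : ∃ n : ℕ, n = Int.gcd u.1 u.2 := ⟨_, rfl⟩
  rw [← hn] at hd he ⊢
  have hcr : cross u v = n * cross (d, e) v := by
    simp only [cross]
    rw [hd, he]
    ring
  have hn0 : n ≠ 0 := by
    rintro rfl
    simp [hcr] at huv
  have hn1 : (1 : ℤ) ≤ n := by exact_mod_cast Nat.one_le_iff_ne_zero.2 hn0
  have hn1R : (1 : ℝ) ≤ n := by exact_mod_cast Nat.one_le_iff_ne_zero.2 hn0
  rw [hcr] at huv
  have hpos : 0 < cross (d, e) v := (mul_pos_iff_of_pos_left (by linarith)).1 huv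
  have hmem : intPoint (p + (d, e)) ∈ K := by
    have := hK hp hpu (a := 1 - 1 / (n : ℝ)) (b := 1 / n)
      (sub_nonneg.2 ((div_le_one (by linarith)).2 hn1R)) (by positivity) (by ring)
    have h1 : (u.1 : ℝ) = n * d := by exact_mod_cast hd
    have h2 : (u.2 : ℝ) = n * e := by exact_mod_cast he
    convert this using 1
    refine Prod.ext ?_ ?_ <;> simp [h1, h2] <;> field_simp <;> ring
  have := hfree _ hmem (by rwa [add_sub_cancel_left])
  rw [add_sub_cancel_left, hcr] at this
  have : (n : ℤ) ≤ 1 := by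
    by_contra hlt
    nlinarith
  omega

/-- Two lattice segments of `P` and of `Q` spanning an area at least two: one of the polygons has a
lattice point in the open strip spanned by its segment in the direction of the other one. -/
theorem exists_intPoint_mem_strip {P Q : Set (ℝ × ℝ)} (hP : Convex ℝ P) (hQ : Convex ℝ Q)
    (hfin : {z | intPoint z ∈ P}.Finite) (hPQ : EdgesPersist P Q) {p u q v : ℤ × ℤ}
    (hp : intPoint p ∈ P) (hpu : intPoint (p + u) ∈ P) (hq : intPoint q ∈ Q)
    (hqv : intPoint (q + v) ∈ Q) (huv : 2 ≤ cross u v) :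
    (∃ w, intPoint w ∈ P ∧ 0 < cross (w - p) v ∧ cross (w - p) v < cross u v) ∨
      ∃ w, intPoint w ∈ Q ∧ 0 < cross u (w - q) ∧ cross u (w - q) < cross u v := by
  by_contra! hcon
  obtain ⟨hPfree, hQfree⟩ := hcon
  have hucop := isCoprime_of_strip_free hP hp hpu (by omega) hPfree
  have hvcop : IsCoprime v.1 v.2 := by
    have hneg : ∀ w : ℤ × ℤ, cross w (-u) = cross u w := fun w => by simp [cross]; ring
    refine isCoprime_of_strip_free hQ hq hqv (v := -u) (by rw [hneg]; omega) ?_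
    simpa only [hneg] using hQfree
  obtain ⟨b, hb⟩ : ∃ b, b = cross u v := ⟨_, rfl⟩
  rw [← hb] at huv hPfree hQfree
  -- Bézout completes `u` to a lattice basis; adding a multiple of `u` to the second basis vector
  -- reduces the coefficient of `v` along `u` modulo `b`. The remainder is nonzero, since otherwise
  -- `b ≥ 2` would divide the primitive vector `v`.
  obtain ⟨a, g, ha, hab, hug, hv1, hv2⟩ : ∃ (a : ℤ) (g : ℤ × ℤ), 0 < a ∧ a < b ∧ cross u g = 1 ∧
      v.1 = -a * u.1 + b * g.1 ∧ v.2 = -a * u.2 + b * g.2 := by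
    obtain ⟨r, s, hrs⟩ := hucop
    obtain ⟨m, hm⟩ : ∃ m, m = v.1 * r + v.2 * s := ⟨_, rfl⟩
    have hv1 : v.1 = m * u.1 + b * -s := by
      rw [hm, hb]
      simp only [cross]
      linear_combination -v.1 * hrs
    have hv2 : v.2 = m * u.2 + b * r := by
      rw [hm, hb]
      simp only [cross]
      linear_combination -v.2 * hrs
    have hdiv := Int.emod_add_mul_ediv (-m) b
    have hne : (-m) % b ≠ 0 := fun h0 => by
      rw [h0, zero_add] at hdiv
      have hbm : b ∣ m := ⟨-((-m) / b), by linarith⟩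
      have h1 : b ∣ v.1 := hv1 ▸ dvd_add (hbm.mul_right _) (dvd_mul_right _ _)
      have h2 : b ∣ v.2 := hv2 ▸ dvd_add (hbm.mul_right _) (dvd_mul_right _ _)
      have := Int.isUnit_iff.1 (hvcop.isUnit_of_dvd' h1 h2)
      omega
    refine ⟨(-m) % b, (-s - (-m) / b * u.1, r - (-m) / b * u.2),
      lt_of_le_of_ne (Int.emod_nonneg _ (by omega)) hne.symm, Int.emod_lt_of_pos _ (by omega),
      ?_, ?_, ?_⟩
    · simp only [cross]
      linear_combination hrs
    · linear_combination hv1 + u.1 * hdiv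
    · linear_combination hv2 + u.2 * hdiv
  have hug' : u.1 * g.2 - u.2 * g.1 = 1 := hug
  have hE := hPQ.frameSet (o := p) (o' := q) hug
  have hP' := hP.frameSet (o := p) (u := u) (g := g)
  have hQ' := hQ.frameSet (o := q) (u := u) (g := g)
  have hfin' := finite_frameSet (o := p) hug hfin
  have hP0 : intPoint (0, 0) ∈ frameSet P p u g := by
    rw [intPoint_mem_frameSet]
    simpa using hp
  have hP1 : intPoint (1, 0) ∈ frameSet P p u g := by
    rw [intPoint_mem_frameSet]
    simpa using (show intPoint (p.1 + u.1, p.2 + u.2) ∈ P from hpu)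
  have hQ0 : intPoint (0, 0) ∈ frameSet Q q u g := by
    rw [intPoint_mem_frameSet]
    simpa using hq
  have hQ1 : intPoint (-a, b) ∈ frameSet Q q u g := by
    rw [intPoint_mem_frameSet]
    convert hqv using 2
    refine Prod.ext ?_ ?_ <;> simp only [Prod.fst_add, Prod.snd_add]
    · linear_combination -hv1
    · linear_combination -hv2
  have hfreeP : ∀ m n : ℤ, intPoint (m, n) ∈ frameSet P p u g →
      b * m + a * n ≤ 0 ∨ b ≤ b * m + a * n := by
    intro m n hmn
    have := hPfree _ (intPoint_mem_frameSet.1 hmn)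
    have hcr : cross ((p.1 + m * u.1 + n * g.1, p.2 + m * u.2 + n * g.2) - p) v =
        b * m + a * n := by
      simp only [cross, Prod.fst_sub, Prod.snd_sub, hv1, hv2]
      linear_combination (b * m + a * n) * hug'
    dsimp only at this
    rw [hcr] at this
    by_contra! h
    linarith [this h.1]
  have hfreeQ : ∀ m n : ℤ, intPoint (m, n) ∈ frameSet Q q u g → n ≤ 0 ∨ b ≤ n := by
    intro m n hmn
    have := hQfree _ (intPoint_mem_frameSet.1 hmn)
    have hcr : cross u ((q.1 + m * u.1 + n * g.1, q.2 + m * u.2 + n * g.2) - q) = n := by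
      simp only [cross, Prod.fst_sub, Prod.snd_sub]
      linear_combination n * hug'
    dsimp only at this
    rw [hcr] at this
    by_contra! h
    linarith [this h.1]
  simp only [intPoint, Int.cast_zero, Int.cast_one, Int.cast_neg] at hP0 hP1 hQ0 hQ1 hfreeP hfreeQ
  -- The reflection `x ↦ (1, 0) - x` preserves the base segment and its strip, so the upper edge of
  -- the reflected set is a lower edge of `P`.
  have hflip : ∀ z : ℤ × ℤ, intPoint z ∈ {x | ((1 : ℝ), (0 : ℝ)) - x ∈ frameSet P p u g} ↔
      intPoint (1 - z.1, -z.2) ∈ frameSet P p u g := fun z => by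
    simp [intPoint]
  obtain ⟨m, n, d, e, hd, hde, hcop, hl, hr, hmax⟩ :=
    exists_upper_edge hP' hfin' ha hab hP0 hP1 hfreeP
  obtain ⟨m', n', d', e', hd', hde', hcop', hl', hr', hmax'⟩ :=
    exists_upper_edge (hP'.preimage_sub_left ((1 : ℝ), (0 : ℝ)))
      (by
        have hinj : Function.Injective fun z : ℤ × ℤ => (1 - z.1, -z.2) := fun x y h => by
          simp only [Prod.mk.injEq] at h
          exact Prod.ext (by linarith) (by linarith)
        exact (hfin'.preimage hinj.injOn).subset fun z hz => (hflip z).1 hz)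
      ha hab (by simpa using hP1) (by rw [Set.mem_ofPred_eq, sub_self]; exact hP0)
      (fun m n hmn => by
        have := hfreeP (1 - m) (-n) ((hflip (m, n)).1 hmn)
        rw [mul_sub, mul_neg] at this
        omega)
  obtain ⟨l, h1, h2, h3⟩ := hE (m, n) (d, e) hcop hl hr
    (fun x hx => hmax x.1 x.2 hx)
  obtain ⟨r, h1', h2', h3'⟩ := hE (1 - m', -n') (-d', -e') hcop'.neg_neg ((hflip (m', n')).1 hl')
    (by
      convert (hflip (m' + d', n' + e')).1 hr' using 2
      refine Prod.ext ?_ ?_ <;> simp <;> ring)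
    (fun x hx => by
      have := hmax' (1 - x.1) (-x.2) ((hflip (1 - x.1, -x.2)).2 (by simpa using hx))
      simp only [cross, Prod.fst_sub, Prod.snd_sub]
      linarith)
  refine not_strip_free hQ' ha hab hQ0 hQ1 hfreeQ hd hde h1 h2 ?_ hd' hde' h1' h2' ?_
  · exact h3 (-a, b) (by simpa [intPoint] using hQ1)
  · have := h3' (0, 0) (by simpa [intPoint] using hQ0)
    simp only [cross, Prod.fst_sub, Prod.snd_sub] at this
    linarith

/-! ### Unimodular triangles in a lattice polygon -/

/-- The point `y` lies in the triangle with the integral vertices `a`, `b`, `c`. -/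
def InTriangle (a b c : ℤ × ℤ) (y : ℝ × ℝ) : Prop :=
  ∃ r s t : ℝ, 0 ≤ r ∧ 0 ≤ s ∧ 0 ≤ t ∧ r + s + t = 1 ∧
    y = r • intPoint a + s • intPoint b + t • intPoint c

/-- The point `y` lies in a unimodular triangle with vertices in `K`. -/
def InUnimodularTriangle (K : Set (ℝ × ℝ)) (y : ℝ × ℝ) : Prop :=
  ∃ a b c : ℤ × ℤ, intPoint a ∈ K ∧ intPoint b ∈ K ∧ intPoint c ∈ K ∧
    IsUnit (cross (b - a) (c - a)) ∧ InTriangle a b c y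

theorem intPoint_mem_of_inTriangle {K : Set (ℝ × ℝ)} (hK : Convex ℝ K) {a b c : ℤ × ℤ}
    (ha : intPoint a ∈ K) (hb : intPoint b ∈ K) (hc : intPoint c ∈ K) {y : ℝ × ℝ}
    (h : InTriangle a b c y) : y ∈ K := by
  obtain ⟨r, s, t, hr, hs, ht, hrst, rfl⟩ := h
  have := hK.sum_mem (t := Finset.univ) (w := ![r, s, t])
    (z := ![intPoint a, intPoint b, intPoint c])
    (by intro i _; fin_cases i <;> simpa) (by simpa [Fin.sum_univ_three] using hrst)
    (by intro i _; fin_cases i <;> simpa)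
  simpa [Fin.sum_univ_three] using this

/-- A parallelogram of area at least two has a nonzero lattice point in its lower half. -/
theorem exists_lattice_combination {d e : ℤ × ℤ} (h : 2 ≤ |cross d e|) :
    ∃ (z : ℤ × ℤ) (s t : ℝ), 0 ≤ s ∧ 0 ≤ t ∧ s < 1 ∧ t < 1 ∧ s + t ≤ 1 ∧ 0 < s + t ∧
      intPoint z = s • intPoint d + t • intPoint e := by
  obtain ⟨N, hN⟩ : ∃ N, N = cross d e := ⟨_, rfl⟩
  rw [← hN] at h
  have hN0 : N ≠ 0 := by
    rintro rfl
    simp at h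
  have hNR : (N : ℝ) ≠ 0 := by exact_mod_cast hN0
  have hNR' : (d.1 * e.2 - d.2 * e.1 : ℝ) = N := by rw [hN]; simp [cross]
  -- Some lattice vector has a non-integral coordinate with respect to `d`, `e`. Otherwise `N` would
  -- divide all entries of the matrix, so `N * N` would divide its determinant `N`.
  obtain ⟨f, hf⟩ : ∃ f : ℤ × ℤ, ¬(N ∣ cross f e ∧ N ∣ cross d f) := by
    by_contra! hall
    obtain ⟨h1, h2⟩ := hall (1, 0)
    obtain ⟨h3, h4⟩ := hall (0, 1)
    simp only [cross, one_mul, zero_mul, mul_one, mul_zero, sub_zero, zero_sub, dvd_neg]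
      at h1 h2 h3 h4
    have : N * N ∣ N * 1 := by
      rw [mul_one]
      nth_rw 3 [hN]
      exact dvd_sub (mul_dvd_mul h4 h1) (mul_dvd_mul h2 h3)
    have := Int.isUnit_iff.1 (isUnit_of_dvd_one ((mul_dvd_mul_iff_left hN0).1 this))
    rcases this with rfl | rfl <;> simp at h
  obtain ⟨x, hx⟩ : ∃ x : ℝ, x = (cross f e : ℝ) / N := ⟨_, rfl⟩
  obtain ⟨y, hy⟩ : ∃ y : ℝ, y = (cross d f : ℝ) / N := ⟨_, rfl⟩
  have hx' : x * N = f.1 * e.2 - f.2 * e.1 := by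
    rw [hx, div_mul_cancel₀ _ hNR]
    simp [cross]
  have hy' : y * N = d.1 * f.2 - d.2 * f.1 := by
    rw [hy, div_mul_cancel₀ _ hNR]
    simp [cross]
  have hz : intPoint (f - ⌊x⌋ • d - ⌊y⌋ • e) =
      Int.fract x • intPoint d + Int.fract y • intPoint e := by
    rw [← Int.self_sub_floor, ← Int.self_sub_floor]
    refine Prod.ext ?_ ?_ <;> apply mul_right_cancel₀ hNR <;> 
      simp [-Int.self_sub_floor, -mul_eq_mul_right_iff]
    · linear_combination -f.1 * hNR' - d.1 * hx' - e.1 * hy'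
    · linear_combination -f.2 * hNR' - d.2 * hx' - e.2 * hy'
  have hfr : ¬(Int.fract x = 0 ∧ Int.fract y = 0) := by
    rintro ⟨h1, h2⟩
    refine hf ⟨⟨⌊x⌋, ?_⟩, ⟨⌊y⌋, ?_⟩⟩
    · have h3 : x = ⌊x⌋ := by rw [Int.fract] at h1; linarith
      rw [hx, div_eq_iff hNR, ← hx, mul_comm] at h3
      exact_mod_cast h3
    · have h3 : y = ⌊y⌋ := by rw [Int.fract] at h2; linarith
      rw [hy, div_eq_iff hNR, ← hy, mul_comm] at h3
      exact_mod_cast h3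
  have hx0 := Int.fract_nonneg x
  have hy0 := Int.fract_nonneg y
  have hx1 := Int.fract_lt_one x
  have hy1 := Int.fract_lt_one y
  have hpos : 0 < Int.fract x + Int.fract y := by
    by_contra hle
    exact hfr ⟨by linarith, by linarith⟩
  -- A point in the upper half is reflected through the centre of the parallelogram. Its coordinates
  -- sum to more than 1 with each below 1, so both are positive and the reflected ones stay below 1.
  rcases le_or_gt (Int.fract x + Int.fract y) 1 with hle | hgt
  · exact ⟨_, _, _, hx0, hy0, hx1, hy1, hle, hpos, hz⟩
  · refine ⟨d + e - (f - ⌊x⌋ • d - ⌊y⌋ • e), 1 - Int.fract x, 1 - Int.fract y, by linarith,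
      by linarith, by linarith, by linarith, by linarith, by linarith, ?_⟩
    have hsub : ∀ z w : ℤ × ℤ, intPoint (z - w) = intPoint z - intPoint w := fun z w => by
      refine Prod.ext ?_ ?_ <;> simp
    rw [hsub, hz]
    refine Prod.ext ?_ ?_ <;> simp <;> ring

theorem cross_rotate (a b c : ℤ × ℤ) : cross (c - b) (a - b) = cross (b - a) (c - a) := by
  simp only [cross, Prod.fst_sub, Prod.snd_sub]
  ring

/-- Replacing a vertex of a triangle by one of its points. -/
theorem exists_replace_vertex {a b c w : ℤ × ℤ} {y : ℝ × ℝ} {r₀ r₁ r₂ s₀ s₁ s₂ : ℝ}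
    (hr₂ : 0 ≤ r₂) (hr : r₀ + r₁ + r₂ = 1)
    (hy : y = r₀ • intPoint a + r₁ • intPoint b + r₂ • intPoint c)
    (hs₂ : 0 < s₂) (hs₂' : s₂ < 1) (hs : s₀ + s₁ + s₂ = 1)
    (hw : intPoint w = s₀ • intPoint a + s₁ • intPoint b + s₂ • intPoint c)
    (h₀ : r₂ / s₂ * s₀ ≤ r₀) (h₁ : r₂ / s₂ * s₁ ≤ r₁) (hN : cross (b - a) (c - a) ≠ 0) :
    InTriangle a b w y ∧ cross (b - a) (w - a) ≠ 0 ∧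
      |cross (b - a) (w - a)| < |cross (b - a) (c - a)| := by
  have hw1 : (w.1 : ℝ) = s₀ * a.1 + s₁ * b.1 + s₂ * c.1 := by simpa using congrArg Prod.fst hw
  have hw2 : (w.2 : ℝ) = s₀ * a.2 + s₁ * b.2 + s₂ * c.2 := by simpa using congrArg Prod.snd hw
  have hdiv : r₂ / s₂ * s₂ = r₂ := div_mul_cancel₀ _ hs₂.ne'
  obtain rfl : s₀ = 1 - s₁ - s₂ := by linarith
  have hdet : (cross (b - a) (w - a) : ℝ) = s₂ * cross (b - a) (c - a) := by
    simp only [cross, Prod.fst_sub, Prod.snd_sub]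
    push_cast
    rw [hw1, hw2]
    ring
  have hNR : (cross (b - a) (c - a) : ℝ) ≠ 0 := by exact_mod_cast hN
  -- The weight `r₂ / s₂` on `w` accounts for exactly the share of `c` in `y`; `h₀` and `h₁` keep
  -- the remaining weights nonnegative.
  refine ⟨⟨r₀ - r₂ / s₂ * (1 - s₁ - s₂), r₁ - r₂ / s₂ * s₁, r₂ / s₂, by linarith, by linarith,
    div_nonneg hr₂ hs₂.le, by linarith, ?_⟩, ?_, ?_⟩
  · rw [hw, hy]
    nth_rw 1 [← hdiv]
    module
  · have := mul_ne_zero hs₂.ne' hNR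
    rw [← hdet] at this
    exact_mod_cast this
  · have h1 : |(cross (b - a) (w - a) : ℝ)| < |(cross (b - a) (c - a) : ℝ)| := by
      rw [hdet, abs_mul, abs_of_pos hs₂]
      exact mul_lt_of_lt_one_left (abs_pos.2 hNR) hs₂'
    exact_mod_cast h1

/-- Every point of a nondegenerate lattice triangle in a convex set lies in a unimodular one. -/
theorem inUnimodularTriangle_of_inTriangle {K : Set (ℝ × ℝ)} (hK : Convex ℝ K) (n : ℕ) :
    ∀ {a b c : ℤ × ℤ} {y : ℝ × ℝ}, intPoint a ∈ K → intPoint b ∈ K → intPoint c ∈ K →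
      InTriangle a b c y → cross (b - a) (c - a) ≠ 0 → |cross (b - a) (c - a)| ≤ n →
      InUnimodularTriangle K y := by
  induction n with
  | zero =>
    intro a b c y _ _ _ _ h0 hle
    exact absurd (abs_nonpos_iff.1 (by simpa using hle)) h0
  | succ n ih =>
    intro a b c y ha hb hc hy h0 hle
    rcases lt_or_ge |cross (b - a) (c - a)| 2 with hlt | hge
    · have : 0 < |cross (b - a) (c - a)| := abs_pos.2 h0
      exact ⟨a, b, c, ha, hb, hc, Int.isUnit_iff_abs_eq.2 (by omega), hy⟩
    -- The triangle is subdivided at the lattice point `a + z`. All three of its barycentric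
    -- coordinates are below 1, so replacing any vertex of positive coordinate strictly decreases
    -- the area.
    · obtain ⟨z, s, t, hs, ht, hs1, ht1, hst, hst0, hz⟩ := exists_lattice_combination hge
      obtain ⟨r₀, r₁, r₂, hr₀, hr₁, hr₂, hr, hyr⟩ := id hy
      have hw : intPoint (a + z) =
          (1 - s - t) • intPoint a + s • intPoint b + t • intPoint c := by
        have h1 : intPoint (a + z) = intPoint a + intPoint z := by
          refine Prod.ext ?_ ?_ <;> simp
        rw [h1, hz]
        refine Prod.ext ?_ ?_ <;> simp <;> ring
      have hwK : intPoint (a + z) ∈ K := intPoint_mem_of_inTriangle hK ha hb hc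
        ⟨_, _, _, by linarith, hs, ht, by ring, hw⟩
      obtain ⟨w, hwdef⟩ : ∃ w, w = a + z := ⟨_, rfl⟩
      rw [← hwdef] at hw hwK
      push_cast at hle
      -- The vertex with the smallest ratio of barycentric coordinates is replaced.
      let ρ : Fin 3 → ℝ := ![r₀, r₁, r₂]
      let σ : Fin 3 → ℝ := ![1 - s - t, s, t]
      have hρ : ∀ i, 0 ≤ ρ i := by intro i; fin_cases i <;> simpa [ρ]
      have hσ : ∀ i, 0 ≤ σ i := by
        intro i
        fin_cases i
        · simp only [σ]
          change 0 ≤ 1 - s - t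
          linarith
        · exact hs
        · exact ht
      obtain ⟨i, hi, hmin⟩ := (Finset.univ.filter fun i => 0 < σ i).exists_min_image
        (fun i => ρ i / σ i) (by
          by_cases hs0 : 0 < s
          · exact ⟨1, by simpa [σ] using hs0⟩
          · exact ⟨2, by simpa [σ] using (by linarith : 0 < t)⟩)
      simp only [Finset.mem_filter, Finset.mem_univ, true_and] at hi hmin
      have hmin' : ∀ j, ρ i / σ i * σ j ≤ ρ j := by
        intro j
        rcases (hσ j).eq_or_lt with hj | hj
        · rw [← hj, mul_zero]
          exact hρ j
        · exact (le_div_iff₀ hj).1 (hmin j hj)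
      fin_cases i
      · obtain ⟨h1, h2, h3⟩ := exists_replace_vertex (a := b) (b := c) (c := a) (w := w) (y := y)
          hr₀ (by linarith : r₁ + r₂ + r₀ = 1) (by rw [hyr]; abel) hi
          (by simp only [σ]; change 1 - s - t < 1; linarith)
          (by simp only [σ]; change s + t + (1 - s - t) = 1; ring)
          (by rw [hw]; simp only [σ]; change _ = s • _ + t • _ + (1 - s - t) • _; abel)
          (hmin' 1) (hmin' 2) (by rwa [cross_rotate])
        rw [cross_rotate a b c] at h3
        exact ih hb hc hwK h1 h2 (by omega)
      · obtain ⟨h1, h2, h3⟩ := exists_replace_vertex (a := c) (b := a) (c := b) (w := w) (y := y)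
          hr₁ (by linarith : r₂ + r₀ + r₁ = 1) (by rw [hyr]; abel) hi hs1
          (by simp only [σ]; change t + (1 - s - t) + s = 1; ring)
          (by rw [hw]; simp only [σ]; change _ = t • _ + (1 - s - t) • _ + s • _; abel)
          (hmin' 2) (hmin' 0) (by rwa [cross_rotate, cross_rotate])
        rw [cross_rotate b c a, cross_rotate a b c] at h3
        exact ih hc ha hwK h1 h2 (by omega)
      · obtain ⟨h1, h2, h3⟩ := exists_replace_vertex (a := a) (b := b) (c := c) (w := w) (y := y)
          hr₂ hr hyr hi ht1
          (by simp only [σ]; change (1 - s - t) + s + t = 1; ring) hw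
          (hmin' 0) (hmin' 1) h0
        exact ih ha hb hwK h1 h2 (by omega)

/-- A two-dimensional lattice polygon in `ℝ × ℝ`, described by its lattice points. -/
structure IsPlanarLatticePolygon (K : Set (ℝ × ℝ)) : Prop where
  convex : Convex ℝ K
  finite : {z | intPoint z ∈ K}.Finite
  subset_hull : K ⊆ convexHull ℝ (intPoint '' {z | intPoint z ∈ K})
  nondegenerate : ∃ a b c : ℤ × ℤ, intPoint a ∈ K ∧ intPoint b ∈ K ∧ intPoint c ∈ K ∧
    cross (b - a) (c - a) ≠ 0

theorem AffineIndependent.eq_zero_of_sum_eq_zero_of_sum_smul {E : Type*} [AddCommGroup E]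
    [Module ℝ E] {t : Finset E} (ht : AffineIndependent ℝ ((↑) : t → E)) {w : E → ℝ}
    (h0 : ∑ x ∈ t, w x = 0) (h1 : ∑ x ∈ t, w x • x = 0) {x : E} (hx : x ∈ t) : w x = 0 := by
  refine affineIndependent_iff.1 ht Finset.univ (fun x => w x) ?_ ?_ ⟨x, hx⟩ (Finset.mem_univ _)
  · rwa [Finset.sum_coe_sort t w]
  · rwa [Finset.sum_coe_sort t fun x => w x • x]

theorem AffineIndependent.finset_card_le {E : Type*} [AddCommGroup E] [Module ℝ E]
    [FiniteDimensional ℝ E] {t : Finset E} (ht : AffineIndependent ℝ ((↑) : t → E)) :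
    t.card ≤ Module.finrank ℝ E + 1 := by
  have := ht.card_le_finrank_succ
  rw [Fintype.card_coe] at this
  exact this.trans (Nat.add_le_add_right (Submodule.finrank_le _) 1)

/-- A vanishing determinant yields linear relations between the edge vectors whose coefficients are
their own coordinates. Affine independence kills these coefficients, forcing two vertices to
coincide. -/
theorem cross_ne_zero_of_affineIndependent {a b c : ℤ × ℤ} {t : Finset (ℝ × ℝ)}
    (ht : AffineIndependent ℝ ((↑) : t → ℝ × ℝ)) (hab : intPoint a ≠ intPoint b)
    (hac : intPoint a ≠ intPoint c) (hbc : intPoint b ≠ intPoint c)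
    (htabc : t = {intPoint a, intPoint b, intPoint c}) : cross (b - a) (c - a) ≠ 0 := by
  classical
  intro h0
  have key : ∀ β γ : ℝ, β * (b.1 - a.1) + γ * (c.1 - a.1) = 0 →
      β * (b.2 - a.2) + γ * (c.2 - a.2) = 0 → β = 0 ∧ γ = 0 := by
    intro β γ h1 h2
    let w : ℝ × ℝ → ℝ := fun x => if x = intPoint b then β else if x = intPoint c then γ else -β - γ
    have hwa : w (intPoint a) = -β - γ := by simp [w, hab, hac]
    have hwb : w (intPoint b) = β := by simp [w]
    have hwc : w (intPoint c) = γ := by simp [w, hbc.symm]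
    have hs0 : ∑ x ∈ t, w x = 0 := by
      rw [htabc, Finset.sum_insert (by simp [hab, hac]), Finset.sum_pair hbc, hwa, hwb, hwc]
      ring
    have hs1 : ∑ x ∈ t, w x • x = 0 := by
      rw [htabc, Finset.sum_insert (by simp [hab, hac]), Finset.sum_pair hbc, hwa, hwb, hwc]
      refine Prod.ext ?_ ?_ <;> simp
      · linarith
      · linarith
    have hb := ht.eq_zero_of_sum_eq_zero_of_sum_smul hs0 hs1 (x := intPoint b) (by simp [htabc])
    have hc := ht.eq_zero_of_sum_eq_zero_of_sum_smul hs0 hs1 (x := intPoint c) (by simp [htabc])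
    exact ⟨hwb ▸ hb, hwc ▸ hc⟩
  have h0' : ((b.1 - a.1) * (c.2 - a.2) - (b.2 - a.2) * (c.1 - a.1) : ℝ) = 0 := by
    have : ((cross (b - a) (c - a) : ℤ) : ℝ) = 0 := by exact_mod_cast h0
    simpa [cross] using this
  have h1 := (key (c.1 - a.1) (-(b.1 - a.1)) (by ring) (by linarith)).2
  have h2 := (key (c.2 - a.2) (-(b.2 - a.2)) (by linarith) (by ring)).2
  exact hab (Prod.ext (by rw [intPoint_fst, intPoint_fst]; linarith)
    (by rw [intPoint_snd, intPoint_snd]; linarith))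

namespace IsPlanarLatticePolygon

variable {K : Set (ℝ × ℝ)}

theorem exists_cross_ne_zero_of_ne (hK : IsPlanarLatticePolygon K) {w w' : ℤ × ℤ} (hne : w ≠ w') :
    ∃ z, intPoint z ∈ K ∧ cross (w' - w) (z - w) ≠ 0 := by
  obtain ⟨a, b, c, ha, hb, hc, h⟩ := hK.nondegenerate
  by_contra! hall
  apply h
  have h1 := hall a ha
  have h2 := hall b hb
  have h3 := hall c hc
  simp only [cross, Prod.fst_sub, Prod.snd_sub] at h1 h2 h3 ⊢
  by_cases h4 : w'.1 - w.1 = 0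
  · have h5 : w'.2 - w.2 ≠ 0 := fun h5 => hne (Prod.ext (by linarith) (by linarith))
    apply mul_left_cancel₀ h5
    linear_combination -(c.2 - a.2) * (h2 - h1) + (b.2 - a.2) * (h3 - h1)
  · apply mul_left_cancel₀ h4
    linear_combination -(c.1 - a.1) * (h2 - h1) + (b.1 - a.1) * (h3 - h1)

theorem exists_ne (hK : IsPlanarLatticePolygon K) (w : ℤ × ℤ) : ∃ z, intPoint z ∈ K ∧ w ≠ z := by
  obtain ⟨a, b, c, ha, hb, hc, h⟩ := hK.nondegenerate
  by_cases hwa : w = a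
  · refine ⟨b, hb, ?_⟩
    rintro rfl
    subst hwa
    simp [cross] at h
  · exact ⟨a, ha, hwa⟩

/-- The segment is a side of a nondegenerate lattice triangle in `K`. This handles the
low-dimensional simplices given by Carathéodory's theorem. -/
theorem inUnimodularTriangle_of_segment (hK : IsPlanarLatticePolygon K) {w w' : ℤ × ℤ}
    (hw : intPoint w ∈ K) (hw' : intPoint w' ∈ K) (hne : w ≠ w') {y : ℝ × ℝ}
    (hy : y ∈ convexHull ℝ {intPoint w, intPoint w'}) : InUnimodularTriangle K y := by
  obtain ⟨z, hz, hcr⟩ := hK.exists_cross_ne_zero_of_ne hne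
  rw [convexHull_pair] at hy
  obtain ⟨r, s, hr, hs, hrs, rfl⟩ := hy
  exact inUnimodularTriangle_of_inTriangle hK.convex (cross (w' - w) (z - w)).natAbs hw hw' hz
    ⟨r, s, 0, hr, hs, le_rfl, by linarith, by simp⟩ hcr (by simp)

/-- A lattice polygon is covered by its unimodular triangles. -/
theorem inUnimodularTriangle (hK : IsPlanarLatticePolygon K) {y : ℝ × ℝ} (hy : y ∈ K) :
    InUnimodularTriangle K y := by
  have hy' := hK.subset_hull hy
  rw [convexHull_eq_union] at hy'
  simp only [Set.mem_iUnion, exists_prop] at hy'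
  obtain ⟨t, htW, hind, hyt⟩ := hy'
  have hcard := hind.finset_card_le
  rw [Module.finrank_prod, Module.finrank_self] at hcard
  have hpt : ∀ x ∈ t, ∃ z, intPoint z ∈ K ∧ intPoint z = x := fun x hx => htW hx
  have hcases : t.card = 0 ∨ t.card = 1 ∨ t.card = 2 ∨ t.card = 3 := by omega
  rcases hcases with h | h | h | h
  · rw [Finset.card_eq_zero.1 h] at hyt
    simp at hyt
  · obtain ⟨x, rfl⟩ := Finset.card_eq_one.1 h
    obtain ⟨z, hz, rfl⟩ := hpt x (by simp)
    obtain ⟨z', hz', hne⟩ := hK.exists_ne z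
    refine hK.inUnimodularTriangle_of_segment hz hz' hne (convexHull_mono ?_ hyt)
    simp
  · obtain ⟨x, x', hne, rfl⟩ := Finset.card_eq_two.1 h
    obtain ⟨z, hz, rfl⟩ := hpt x (by simp)
    obtain ⟨z', hz', rfl⟩ := hpt x' (by simp)
    refine hK.inUnimodularTriangle_of_segment hz hz' (fun h => hne (h ▸ rfl)) ?_
    simpa using hyt
  · obtain ⟨x, x', x'', h1, h2, h3, htx⟩ := Finset.card_eq_three.1 h
    obtain ⟨a, ha, rfl⟩ := hpt x (by simp [htx])
    obtain ⟨b, hb, rfl⟩ := hpt x' (by simp [htx])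
    obtain ⟨c, hc, rfl⟩ := hpt x'' (by simp [htx])
    have hcr := cross_ne_zero_of_affineIndependent hind h1 h2 h3 htx
    refine inUnimodularTriangle_of_inTriangle hK.convex (cross (b - a) (c - a)).natAbs ha hb hc
      ?_ hcr (by simp)
    rw [Finset.mem_convexHull'] at hyt
    obtain ⟨w, hw0, hw1, hwy⟩ := hyt
    rw [htx, Finset.sum_insert (by simp [h1, h2]), Finset.sum_pair h3, ← add_assoc] at hw1 hwy
    exact ⟨_, _, _, hw0 _ (by simp [htx]), hw0 _ (by simp [htx]), hw0 _ (by simp [htx]), hw1,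
      hwy.symm⟩

end IsPlanarLatticePolygon

/-! ### Covering the slab between two polygons -/

/-- The point `s • p + t • q` of the slab between `P` and `Q` lies in a unimodular simplex with
vertices in `P` and `Q`. -/
def Covered (P Q : Set (ℝ × ℝ)) (s t : ℝ) (x : ℝ × ℝ) : Prop :=
  (∃ y q, InUnimodularTriangle P y ∧ intPoint q ∈ Q ∧ x = s • y + t • intPoint q) ∨
  (∃ p y, intPoint p ∈ P ∧ InUnimodularTriangle Q y ∧ x = s • intPoint p + t • y) ∨
  ∃ p u q v : ℤ × ℤ, intPoint p ∈ P ∧ intPoint (p + u) ∈ P ∧ intPoint q ∈ Q ∧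
    intPoint (q + v) ∈ Q ∧ IsUnit (cross u v) ∧ ∃ l m : ℝ, 0 ≤ l ∧ l ≤ 1 ∧ 0 ≤ m ∧ m ≤ 1 ∧
      x = s • (intPoint p + l • intPoint u) + t • (intPoint q + m • intPoint v)

/-- Turns a slab upside down, so that edges may persist from either side. -/
theorem Covered.symm {P Q : Set (ℝ × ℝ)} {s t : ℝ} {x : ℝ × ℝ} (h : Covered P Q s t x) :
    Covered Q P t s x := by
  rcases h with ⟨y, q, hy, hq, rfl⟩ | ⟨p, y, hp, hy, rfl⟩ |
    ⟨p, u, q, v, hp, hpu, hq, hqv, huv, l, m, hl, hl1, hm, hm1, rfl⟩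
  · exact Or.inr (Or.inl ⟨q, y, hq, hy, add_comm _ _⟩)
  · exact Or.inl ⟨y, p, hy, hp, add_comm _ _⟩
  · refine Or.inr (Or.inr ⟨q, v, p, u, hq, hqv, hp, hpu, ?_, m, l, hm, hm1, hl, hl1,
      add_comm _ _⟩)
    have : cross v u = -cross u v := by simp only [cross]; ring
    rw [this]
    exact huv.neg

section Slide

variable {C : ℝ × ℝ → Prop} {Q : Set (ℝ × ℝ)} {s t : ℝ} {p u : ℝ × ℝ}

/-- Moving a point of `Q` in the direction of `u`. -/
theorem slide (hQ : Convex ℝ Q) (hs : 0 ≤ s) (ht : 0 ≤ t)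
    (h0 : ∀ y ∈ Q, C (s • p + t • y)) (h1 : ∀ y ∈ Q, C (s • (p + u) + t • y))
    {c : ℝ × ℝ} {h l : ℝ} (hc : c ∈ Q) (hc' : c - h • u ∈ Q) (hl : 0 ≤ l) (hl1 : l ≤ 1)
    (hC : ∀ l : ℝ, 0 ≤ l → l ≤ 1 → C (s • (p + l • u) + t • c)) :
    C (s • (p + l • u) + t • (c - h • u)) := by
  have hmem : ∀ r : ℝ, 0 ≤ r → r ≤ 1 → c - (r * h) • u ∈ Q := by
    intro r hr hr1
    have := hQ hc hc' (sub_nonneg.2 hr1) hr (by ring)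
    convert this using 1
    module
  rcases hs.eq_or_lt with rfl | hs
  · have := h0 _ hc'
    rw [zero_smul] at this ⊢
    exact this
  -- The shift by `-h • u` in `Q` can be traded for a change of `l` to `l - t * h / s` in the other
  -- factor. If the new value leaves `[0, 1]`, only the part of the shift that reaches `0` or `1` is
  -- traded, and the point lies in the cone over `Q` with apex `p` or `p + u`.
  have hdiv : s * (t * h / s) = t * h := mul_div_cancel₀ _ hs.ne'
  by_cases hlow : s * l - t * h < 0
  · have hth : 0 < t * h := by nlinarith [mul_nonneg hs.le hl]
    have ht0 : 0 < t := lt_of_le_of_ne ht fun h => by rw [← h] at hth; simp at hth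
    have hh : 0 < h := (mul_pos_iff_of_pos_left ht0).1 hth
    have := h0 _ (hmem (1 - s * l / (t * h))
      (sub_nonneg.2 ((div_le_one hth).2 (by linarith)))
      (sub_le_self _ (div_nonneg (mul_nonneg hs.le hl) hth.le)))
    convert this using 1
    match_scalars <;> field_simp
    all_goals ring
  by_cases hhigh : s < s * l - t * h
  · have hth : t * h < 0 := by nlinarith [mul_nonneg hs.le (sub_nonneg.2 hl1)]
    have ht0 : 0 < t := lt_of_le_of_ne ht fun h => by rw [← h] at hth; simp at hth
    have hh : h ≠ 0 := by rintro rfl; simp at hth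
    have := h1 _ (hmem (1 - s * (1 - l) / (-(t * h)))
      (sub_nonneg.2 ((div_le_one (by linarith)).2 (by linarith)))
      (sub_le_self _ (div_nonneg (mul_nonneg hs.le (sub_nonneg.2 hl1)) (by linarith))))
    convert this using 1
    match_scalars <;> field_simp
    all_goals ring
  rw [not_lt] at hlow hhigh
  have := hC (l - t * h / s)
    (by rw [sub_nonneg, div_le_iff₀ hs]; linarith)
    (by rw [sub_le_iff_le_add, ← sub_le_iff_le_add', le_div_iff₀ hs]; linarith)
  convert this using 1
  match_scalars <;> field_simp
  ring

/-- Replacing a segment of `Q` by a chain of two segments with monotone heights over `u`. -/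
theorem mixed_split (hQ : Convex ℝ Q) (hs : 0 ≤ s) (ht : 0 ≤ t)
    (h0 : ∀ y ∈ Q, C (s • p + t • y)) (h1 : ∀ y ∈ Q, C (s • (p + u) + t • y))
    {q v w : ℝ × ℝ} {ξ η : ℝ} (hq : q ∈ Q) (hqv : q + v ∈ Q) (hw : w ∈ Q)
    (hη : 0 < η) (hη1 : η < 1) (hweq : w = q + ξ • u + η • v)
    (hC : ∀ l m : ℝ, 0 ≤ l → l ≤ 1 → 0 ≤ m → m ≤ 1 →
      C (s • (p + l • u) + t • (q + m • (w - q))))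
    (hC' : ∀ l m : ℝ, 0 ≤ l → l ≤ 1 → 0 ≤ m → m ≤ 1 →
      C (s • (p + l • u) + t • (w + m • (q + v - w))))
    {l m : ℝ} (hl : 0 ≤ l) (hl1 : l ≤ 1) (hm : 0 ≤ m) (hm1 : m ≤ 1) :
    C (s • (p + l • u) + t • (q + m • v)) := by
  have hqm : q + m • v ∈ Q := by
    convert hQ hq hqv (sub_nonneg.2 hm1) hm (by ring) using 1
    module
  -- On each half of the chain, the parameter is chosen so that the point has the same
  -- `v`-coordinate as `q + m • v`. The two points then differ by a multiple of `u`, which `slide`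
  -- absorbs.
  rcases le_or_gt m η with hmη | hmη
  · have hr0 : 0 ≤ m / η := div_nonneg hm hη.le
    have hr1 : m / η ≤ 1 := (div_le_one hη).2 hmη
    have heq : q + m • v = q + (m / η) • (w - q) - (m / η * ξ) • u := by
      rw [hweq]
      match_scalars <;> field_simp <;> ring
    rw [heq] at hqm ⊢
    refine slide hQ hs ht h0 h1 ?_ hqm hl hl1 fun l hl hl1 => hC l _ hl hl1 hr0 hr1
    convert hQ hq hw (sub_nonneg.2 hr1) hr0 (by ring) using 1
    module
  · have hη' : 0 < 1 - η := by linarith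
    have hr0 : 0 ≤ (m - η) / (1 - η) := div_nonneg (by linarith) hη'.le
    have hr1 : (m - η) / (1 - η) ≤ 1 := (div_le_one hη').2 (by linarith)
    have heq : q + m • v = w + ((m - η) / (1 - η)) • (q + v - w) -
        ((1 - m) / (1 - η) * ξ) • u := by
      rw [hweq]
      match_scalars <;> field_simp <;> ring
    rw [heq] at hqm ⊢
    refine slide hQ hs ht h0 h1 ?_ hqm hl hl1 fun l hl hl1 => hC' l _ hl hl1 hr0 hr1
    convert hQ hw hqv (sub_nonneg.2 hr1) hr0 (by ring) using 1
    module

end Slide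

theorem intPoint_add (z w : ℤ × ℤ) : intPoint (z + w) = intPoint z + intPoint w := by
  refine Prod.ext ?_ ?_ <;> simp

theorem intPoint_sub (z w : ℤ × ℤ) : intPoint (z - w) = intPoint z - intPoint w := by
  refine Prod.ext ?_ ?_ <;> simp

theorem intPoint_eq_combination {w u v : ℤ × ℤ} (h : cross u v ≠ 0) :
    intPoint w = ((cross w v : ℝ) / cross u v) • intPoint u +
      ((cross u w : ℝ) / cross u v) • intPoint v := by
  have hR : (cross u v : ℝ) ≠ 0 := by exact_mod_cast h
  have hR' : (cross u v : ℝ) = u.1 * v.2 - u.2 * v.1 := by simp [cross]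
  refine Prod.ext ?_ ?_ <;> simp only [Prod.fst_add, Prod.snd_add, Prod.smul_fst, Prod.smul_snd,
    smul_eq_mul, intPoint_fst, intPoint_snd] <;> field_simp <;> rw [hR'] <;>
    simp only [cross] <;> push_cast <;> ring

/-- The mixed tetrahedra between two polygons are covered if edges persist. -/
theorem covered_mixed {P Q : Set (ℝ × ℝ)} (hP : IsPlanarLatticePolygon P)
    (hQ : IsPlanarLatticePolygon Q) (hPQ : EdgesPersist P Q) {s t : ℝ} (hs : 0 ≤ s) (ht : 0 ≤ t)
    (n : ℕ) : ∀ {p u q v : ℤ × ℤ}, intPoint p ∈ P → intPoint (p + u) ∈ P → intPoint q ∈ Q →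
      intPoint (q + v) ∈ Q → 0 < cross u v → cross u v ≤ n → ∀ {l m : ℝ}, 0 ≤ l → l ≤ 1 →
      0 ≤ m → m ≤ 1 →
      Covered P Q s t (s • (intPoint p + l • intPoint u) + t • (intPoint q + m • intPoint v)) := by
  induction n with
  | zero =>
    intro p u q v _ _ _ _ h1 h2
    exact absurd h1 (not_lt.2 (by simpa using h2))
  | succ n ih =>
    intro p u q v hp hpu hq hqv hpos hle l m hl hl1 hm hm1
    push_cast at hle
    rcases lt_or_ge (cross u v) 2 with hlt | hge
    · exact Or.inr (Or.inr ⟨p, u, q, v, hp, hpu, hq, hqv,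
        Int.isUnit_iff.2 (Or.inl (by omega)), l, m, hl, hl1, hm, hm1, rfl⟩)
    have hR : (0 : ℝ) < cross u v := by exact_mod_cast hpos
    -- The chain through `w` splits `cross u v` into two positive summands, so both new mixed
    -- tetrahedra fall under the induction hypothesis. When `w` lies in `P`, the factors are
    -- exchanged and the sliding is along `v`.
    rcases exists_intPoint_mem_strip hP.convex hQ.convex hP.finite hPQ hp hpu hq hqv hge with
      ⟨w, hw, hw0, hw1⟩ | ⟨w, hw, hw0, hw1⟩
    · have hw0' : (0 : ℝ) < cross (w - p) v := by exact_mod_cast hw0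
      have hw1' : (cross (w - p) v : ℝ) < cross u v := by exact_mod_cast hw1
      have hcomb := intPoint_eq_combination (w := w - p) hpos.ne'
      rw [intPoint_sub] at hcomb
      have hcr : cross (p + u - w) v = cross u v - cross (w - p) v := by
        simp only [cross, Prod.fst_sub, Prod.snd_sub, Prod.fst_add, Prod.snd_add]
        ring
      rw [add_comm]
      refine mixed_split (C := Covered P Q s t) (w := intPoint w) hP.convex ht hs
        (fun y hy => ?_) (fun y hy => ?_) hp
        (intPoint_add p u ▸ hpu) hw (div_pos hw0' hR) ((div_lt_one hR).2 hw1')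
        (sub_eq_iff_eq_add.1 hcomb |>.trans (by abel)) ?_ ?_ hm hm1 hl hl1
      · exact Or.inl ⟨y, q, hP.inUnimodularTriangle hy, hq, add_comm _ _⟩
      · exact Or.inl ⟨y, q + v, hP.inUnimodularTriangle hy, hqv,
          by rw [intPoint_add, add_comm]⟩
      · intro m l hm hm1 hl hl1
        rw [← intPoint_sub, add_comm]
        exact ih hp (by rwa [add_sub_cancel]) hq hqv hw0 (by omega) hl hl1 hm hm1
      · intro m l hm hm1 hl hl1
        rw [← intPoint_add, ← intPoint_sub, add_comm]
        exact ih hw (by rwa [add_sub_cancel]) hq hqv (by omega) (by omega) hl hl1 hm hm1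
    · have hw0' : (0 : ℝ) < cross u (w - q) := by exact_mod_cast hw0
      have hw1' : (cross u (w - q) : ℝ) < cross u v := by exact_mod_cast hw1
      have hcomb := intPoint_eq_combination (w := w - q) hpos.ne'
      rw [intPoint_sub] at hcomb
      have hcr : cross u (q + v - w) = cross u v - cross u (w - q) := by
        simp only [cross, Prod.fst_sub, Prod.snd_sub, Prod.fst_add, Prod.snd_add]
        ring
      refine mixed_split (C := Covered P Q s t) (w := intPoint w) hQ.convex hs ht
        (fun y hy => ?_) (fun y hy => ?_) hq
        (intPoint_add q v ▸ hqv) hw (div_pos hw0' hR) ((div_lt_one hR).2 hw1')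
        (sub_eq_iff_eq_add.1 hcomb |>.trans (by abel)) ?_ ?_ hl hl1 hm hm1
      · exact Or.inr (Or.inl ⟨p, y, hp, hQ.inUnimodularTriangle hy, rfl⟩)
      · exact Or.inr (Or.inl ⟨p + u, y, hpu, hQ.inUnimodularTriangle hy, by rw [intPoint_add]⟩)
      · intro l m hl hl1 hm hm1
        rw [← intPoint_sub]
        exact ih hp hpu hq (by rwa [add_sub_cancel]) hw0 (by omega) hl hl1 hm hm1
      · intro l m hl hl1 hm hm1
        rw [← intPoint_add, ← intPoint_sub]
        exact ih hp hpu hw (by rwa [add_sub_cancel]) (by omega) (by omega) hl hl1 hm hm1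

/-- Reversing the segment of `Q` changes the sign of the determinant, which reduces to the positive
case. -/
theorem covered_of_segments {P Q : Set (ℝ × ℝ)} {s t : ℝ} {p p' q q' : ℤ × ℤ}
    (hP : IsPlanarLatticePolygon P)
    (hQ : IsPlanarLatticePolygon Q) (hPQ : EdgesPersist P Q) (hs : 0 ≤ s) (ht : 0 ≤ t)
    (hp : intPoint p ∈ P) (hp' : intPoint p' ∈ P) (hq : intPoint q ∈ Q) (hq' : intPoint q' ∈ Q)
    (hcr : cross (p' - p) (q' - q) ≠ 0) {l m : ℝ} (hl : 0 ≤ l) (hl1 : l ≤ 1) (hm : 0 ≤ m)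
    (hm1 : m ≤ 1) :
    Covered P Q s t (s • ((1 - l) • intPoint p + l • intPoint p') +
      t • ((1 - m) • intPoint q + m • intPoint q')) := by
  rcases hcr.lt_or_gt with h | h
  · have hneg : cross (p' - p) (q - q') = -cross (p' - p) (q' - q) := by
      simp only [cross, Prod.fst_sub, Prod.snd_sub]
      ring
    have := covered_mixed hP hQ hPQ hs ht (cross (p' - p) (q - q')).natAbs (u := p' - p)
      (v := q - q') hp
      (by rwa [add_sub_cancel]) hq' (by rwa [add_sub_cancel]) (by omega)
      (by simpa using le_abs_self _) hl hl1 (sub_nonneg.2 hm1) (sub_le_self 1 hm)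
    rw [intPoint_sub, intPoint_sub] at this
    convert this using 1
    module
  · have := covered_mixed hP hQ hPQ hs ht (cross (p' - p) (q' - q)).natAbs (u := p' - p)
      (v := q' - q) hp
      (by rwa [add_sub_cancel]) hq (by rwa [add_sub_cancel]) h
      (by simpa using le_abs_self _) hl hl1 hm hm1
    rw [intPoint_sub, intPoint_sub] at this
    convert this using 1
    module

theorem cross_ne_zero_of_affineIndependent_mixed {p p' q q' : ℤ × ℤ} {B T t : Finset ((ℝ × ℝ) × ℝ)}
    (ht : AffineIndependent ℝ ((↑) : t → (ℝ × ℝ) × ℝ)) (hBT : Disjoint B T)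
    (htBT : t = B.disjUnion T hBT)
    (hp : (intPoint p, (0 : ℝ)) ≠ (intPoint p', 0)) (hq : (intPoint q, (1 : ℝ)) ≠ (intPoint q', 1))
    (hB : B = {(intPoint p, 0), (intPoint p', 0)})
    (hT : T = {(intPoint q, 1), (intPoint q', 1)}) : cross (p' - p) (q' - q) ≠ 0 := by
  classical
  intro h0
  have key : ∀ β γ : ℝ, β * (p'.1 - p.1) + γ * (q'.1 - q.1) = 0 →
      β * (p'.2 - p.2) + γ * (q'.2 - q.2) = 0 → β = 0 ∧ γ = 0 := by
    intro β γ h1 h2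
    let w : (ℝ × ℝ) × ℝ → ℝ := fun x => if x = (intPoint p', 0) then β else
      if x = (intPoint q', 1) then γ else if x = (intPoint p, 0) then -β else -γ
    have hwp' : w (intPoint p', 0) = β := by simp [w]
    have hwq' : w (intPoint q', 1) = γ := by simp [w]
    have hwp : w (intPoint p, 0) = -β := by simp only [w, if_neg hp]; simp
    have hwq : w (intPoint q, 1) = -γ := by simp only [w, if_neg hq]; simp
    have hs0 : ∑ x ∈ t, w x = 0 := by
      rw [htBT, Finset.sum_disjUnion, hB, hT, Finset.sum_pair hp, Finset.sum_pair hq, hwp, hwp',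
        hwq, hwq']
      ring
    have hs1 : ∑ x ∈ t, w x • x = 0 := by
      rw [htBT, Finset.sum_disjUnion, hB, hT, Finset.sum_pair hp, Finset.sum_pair hq, hwp, hwp',
        hwq, hwq']
      refine Prod.ext (Prod.ext ?_ ?_) ?_ <;> simp
      · linarith
      · linarith
    have hb := ht.eq_zero_of_sum_eq_zero_of_sum_smul hs0 hs1 (x := (intPoint p', 0))
      (by simp [htBT, hB])
    have hc := ht.eq_zero_of_sum_eq_zero_of_sum_smul hs0 hs1 (x := (intPoint q', 1))
      (by simp [htBT, hT])
    exact ⟨hwp' ▸ hb, hwq' ▸ hc⟩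
  have h0' : ((p'.1 - p.1) * (q'.2 - q.2) - (p'.2 - p.2) * (q'.1 - q.1) : ℝ) = 0 := by
    have : ((cross (p' - p) (q' - q) : ℤ) : ℝ) = 0 := by exact_mod_cast h0
    simpa [cross] using this
  have h1 := (key (q'.1 - q.1) (-(p'.1 - p.1)) (by ring) (by linarith)).2
  have h2 := (key (q'.2 - q.2) (-(p'.2 - p.2)) (by linarith) (by ring)).2
  refine hp (Prod.ext (Prod.ext ?_ ?_) rfl)
  · change (p.1 : ℝ) = p'.1
    linarith
  · change (p.2 : ℝ) = p'.2
    linarith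

/-- The slab between two lattice polygons `P` and `Q` is covered if every edge of `P` persists
in `Q`. -/
theorem covered_of_edgesPersist {P Q : Set (ℝ × ℝ)} (hP : IsPlanarLatticePolygon P)
    (hQ : IsPlanarLatticePolygon Q) (hPQ : EdgesPersist P Q) {s t : ℝ} (hs : 0 ≤ s) (ht : 0 ≤ t)
    (hst : s + t = 1) {p q : ℝ × ℝ} (hp : p ∈ P) (hq : q ∈ Q) :
    Covered P Q s t (s • p + t • q) := by
  classical
  rcases hs.eq_or_lt with rfl | hs'
  · obtain ⟨a, -, -, ha, -⟩ := hP.nondegenerate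
    exact Or.inr (Or.inl ⟨a, q, ha, hQ.inUnimodularTriangle hq, by simp⟩)
  rcases ht.eq_or_lt with rfl | ht'
  · obtain ⟨a, -, -, ha, -⟩ := hQ.nondegenerate
    exact Or.inl ⟨p, a, hP.inUnimodularTriangle hp, ha, by simp⟩
  -- With `P` at height 0 and `Q` at height 1, Carathéodory's theorem gives a simplex with at most
  -- four lattice vertices; the height coordinate separates the weights of the two layers into
  -- totals `s` and `t`.
  have hmem : (s • p + t • q, t) ∈ convexHull ℝ
      ((intPoint '' {z | intPoint z ∈ P}) ×ˢ {(0 : ℝ)} ∪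
        (intPoint '' {z | intPoint z ∈ Q}) ×ˢ {(1 : ℝ)}) := by
    have h1 : (p, (0 : ℝ)) ∈ convexHull ℝ ((intPoint '' {z | intPoint z ∈ P}) ×ˢ {(0 : ℝ)}) := by
      rw [convexHull_prod]
      exact ⟨hP.subset_hull hp, subset_convexHull ℝ _ rfl⟩
    have h2 : (q, (1 : ℝ)) ∈ convexHull ℝ ((intPoint '' {z | intPoint z ∈ Q}) ×ˢ {(1 : ℝ)}) := by
      rw [convexHull_prod]
      exact ⟨hQ.subset_hull hq, subset_convexHull ℝ _ rfl⟩
    convert convex_convexHull ℝ _ (convexHull_mono Set.subset_union_left h1)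
      (convexHull_mono Set.subset_union_right h2) hs ht hst using 1
    simp
  rw [convexHull_eq_union] at hmem
  simp only [Set.mem_iUnion, exists_prop] at hmem
  obtain ⟨F, hF, hind, hx⟩ := hmem
  have hcard := hind.finset_card_le
  rw [Module.finrank_prod, Module.finrank_prod, Module.finrank_self] at hcard
  set B := F.filter fun z => z.2 = 0 with hB
  set T := F.filter fun z => ¬z.2 = 0 with hT
  have hBT : Disjoint B T := Finset.disjoint_filter_filter_not _ _ _
  have hFBT : F = B.disjUnion T hBT := by
    rw [Finset.disjUnion_eq_union]
    exact (Finset.filter_union_filter_not_eq _ _).symm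
  have hBP : ∀ z ∈ B, ∃ a, intPoint a ∈ P ∧ z = (intPoint a, 0) := by
    intro z hz
    obtain ⟨hzF, hz0⟩ := Finset.mem_filter.1 hz
    rcases hF hzF with ⟨⟨a, ha, haz⟩, -⟩ | ⟨-, h1⟩
    · exact ⟨a, ha, Prod.ext haz.symm hz0⟩
    · rw [Set.mem_singleton_iff] at h1
      rw [h1] at hz0
      norm_num at hz0
  have hTQ : ∀ z ∈ T, ∃ a, intPoint a ∈ Q ∧ z = (intPoint a, 1) := by
    intro z hz
    obtain ⟨hzF, hz0⟩ := Finset.mem_filter.1 hz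
    rcases hF hzF with ⟨-, h1⟩ | ⟨⟨a, ha, haz⟩, h1⟩
    · exact absurd h1 hz0
    · exact ⟨a, ha, Prod.ext haz.symm h1⟩
  rw [Finset.mem_convexHull'] at hx
  obtain ⟨w, hw0, hw1, hwx⟩ := hx
  rw [hFBT, Finset.sum_disjUnion] at hw1 hwx
  have hfst : ∑ z ∈ B, w z • z.1 + ∑ z ∈ T, w z • z.1 = s • p + t • q := by
    simpa [Prod.fst_sum] using congrArg Prod.fst hwx
  have hsnd : ∑ z ∈ T, w z = t := by
    have h1 := congrArg Prod.snd hwx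
    simp only [Prod.snd_add, Prod.snd_sum, Prod.smul_snd, smul_eq_mul] at h1
    rw [Finset.sum_eq_zero (s := B), zero_add] at h1
    · rw [← h1]
      refine Finset.sum_congr rfl fun z hz => ?_
      obtain ⟨a, -, rfl⟩ := hTQ z hz
      simp
    · intro z hz
      obtain ⟨a, -, rfl⟩ := hBP z hz
      simp
  have hsB : ∑ z ∈ B, w z = s := by linarith
  have hwB : ∀ z ∈ B, 0 ≤ w z := fun z hz => hw0 z (Finset.mem_of_mem_filter z hz)
  have hwT : ∀ z ∈ T, 0 ≤ w z := fun z hz => hw0 z (Finset.mem_of_mem_filter z hz)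
  have hBmem : ∃ y ∈ P, ∑ z ∈ B, w z • z.1 = s • y := by
    refine ⟨_, hP.convex.centerMass_mem (z := fun z : (ℝ × ℝ) × ℝ => z.1) hwB
      (by rwa [hsB]) ?_, ?_⟩
    · intro z hz
      obtain ⟨a, ha, rfl⟩ := hBP z hz
      exact ha
    · rw [Finset.centerMass, hsB, smul_smul, mul_inv_cancel₀ hs'.ne', one_smul]
  have hTmem : ∃ y ∈ Q, ∑ z ∈ T, w z • z.1 = t • y := by
    refine ⟨_, hQ.convex.centerMass_mem (z := fun z : (ℝ × ℝ) × ℝ => z.1) hwT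
      (by rwa [hsnd]) ?_, ?_⟩
    · intro z hz
      obtain ⟨a, ha, rfl⟩ := hTQ z hz
      exact ha
    · rw [Finset.centerMass, hsnd, smul_smul, mul_inv_cancel₀ ht'.ne', one_smul]
  have hcardBT : F.card = B.card + T.card := by rw [hFBT, Finset.card_disjUnion]
  have hB0 : B.card ≠ 0 := fun h => by
    rw [Finset.card_eq_zero.1 h] at hsB
    simp at hsB
    linarith
  have hT0 : T.card ≠ 0 := fun h => by
    rw [Finset.card_eq_zero.1 h] at hsnd
    simp at hsnd
    linarith
  rw [← hfst]
  by_cases hT1 : T.card = 1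
  · obtain ⟨z, hz⟩ := Finset.card_eq_one.1 hT1
    obtain ⟨a, ha, rfl⟩ := hTQ z (by simp [hz])
    obtain ⟨y, hy, hyeq⟩ := hBmem
    rw [hz, Finset.sum_singleton] at hsnd
    rw [hyeq, hz, Finset.sum_singleton, hsnd]
    exact Or.inl ⟨y, a, hP.inUnimodularTriangle hy, ha, rfl⟩
  by_cases hB1 : B.card = 1
  · obtain ⟨z, hz⟩ := Finset.card_eq_one.1 hB1
    obtain ⟨a, ha, rfl⟩ := hBP z (by simp [hz])
    obtain ⟨y, hy, hyeq⟩ := hTmem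
    rw [hz, Finset.sum_singleton] at hsB
    rw [hyeq, hz, Finset.sum_singleton, hsB]
    exact Or.inr (Or.inl ⟨a, y, ha, hQ.inUnimodularTriangle hy, rfl⟩)
  -- Neither layer has fewer than two vertices and there are at most four in all, so the simplex is
  -- mixed with two vertices in each.
  obtain ⟨x, x', hxx, hBx⟩ := Finset.card_eq_two.1 (by omega : B.card = 2)
  obtain ⟨z, z', hzz, hTz⟩ := Finset.card_eq_two.1 (by omega : T.card = 2)
  obtain ⟨a, ha, rfl⟩ := hBP x (by simp [hBx])
  obtain ⟨a', ha', rfl⟩ := hBP x' (by simp [hBx])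
  obtain ⟨c, hc, rfl⟩ := hTQ z (by simp [hTz])
  obtain ⟨c', hc', rfl⟩ := hTQ z' (by simp [hTz])
  have hcr := cross_ne_zero_of_affineIndependent_mixed hind hBT hFBT hxx hzz hBx hTz
  have ha0 := hwB (intPoint a, 0) (by simp [hBx])
  have ha0' := hwB (intPoint a', 0) (by simp [hBx])
  have hc0 := hwT (intPoint c, 1) (by simp [hTz])
  have hc0' := hwT (intPoint c', 1) (by simp [hTz])
  rw [hBx, Finset.sum_pair hxx] at hsB ⊢
  rw [hTz, Finset.sum_pair hzz] at hsnd ⊢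
  have := covered_of_segments hP hQ hPQ hs ht ha ha' hc hc' hcr
    (l := w (intPoint a', 0) / s) (m := w (intPoint c', 1) / t) (div_nonneg ha0' hs)
    ((div_le_one hs').2 (by linarith)) (div_nonneg hc0' ht) ((div_le_one ht').2 (by linarith))
  convert this using 1
  have e1 : w (intPoint a, 0) = s * (1 - w (intPoint a', 0) / s) := by
    rw [mul_sub, mul_div_cancel₀ _ hs'.ne']
    linarith
  have e2 : w (intPoint a', 0) = s * (w (intPoint a', 0) / s) := (mul_div_cancel₀ _ hs'.ne').symm
  have e3 : w (intPoint c, 1) = t * (1 - w (intPoint c', 1) / t) := by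
    rw [mul_sub, mul_div_cancel₀ _ ht'.ne']
    linarith
  have e4 : w (intPoint c', 1) = t * (w (intPoint c', 1) / t) := (mul_div_cancel₀ _ ht'.ne').symm
  rw [smul_add, smul_add, smul_smul, smul_smul, smul_smul, smul_smul, ← e1, ← e2, ← e3, ← e4]

/-! ### Integrality and edges of the layers -/

/-- The points dividing segments from `A` to `B` in the ratio `θ : 1 - θ`. -/
def layer (A B : Set (ℝ × ℝ)) (θ : ℝ) : Set (ℝ × ℝ) :=
  {x | ∃ a ∈ A, ∃ b ∈ B, x = (1 - θ) • a + θ • b}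

theorem Convex.layer {A B : Set (ℝ × ℝ)} (hA : Convex ℝ A) (hB : Convex ℝ B) (θ : ℝ) :
    Convex ℝ (layer A B θ) := by
  rintro _ ⟨a, ha, b, hb, rfl⟩ _ ⟨a', ha', b', hb', rfl⟩ s t hs ht hst
  refine ⟨_, hA ha ha' hs ht hst, _, hB hb hb' hs ht hst, ?_⟩
  module

theorem finite_intPoint_mem_of_isBounded {K : Set (ℝ × ℝ)} (hK : Bornology.IsBounded K) :
    {z | intPoint z ∈ K}.Finite := by
  obtain ⟨r, hr⟩ := hK.subset_closedBall 0
  refine (Set.finite_Icc ((-⌈r⌉, -⌈r⌉) : ℤ × ℤ) (⌈r⌉, ⌈r⌉)).subset fun z hz => ?_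
  have h := hr hz
  rw [mem_closedBall_zero_iff, Prod.norm_def, max_le_iff, Real.norm_eq_abs, Real.norm_eq_abs,
    abs_le, abs_le] at h
  obtain ⟨⟨h1, h2⟩, h3, h4⟩ := h
  rw [intPoint_fst] at h1 h2
  rw [intPoint_snd] at h3 h4
  have hc := Int.le_ceil r
  refine ⟨⟨?_, ?_⟩, ?_, ?_⟩ <;> dsimp only <;> rw [← Int.cast_le (R := ℝ)] <;> push_cast <;>
    linarith

theorem layer_subset_convexHull {A B : Set (ℝ × ℝ)} {θ : ℝ} (h0 : 0 ≤ θ) (h1 : θ ≤ 1) :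
    layer A B θ ⊆ convexHull ℝ (A ∪ B) := by
  rintro _ ⟨a, ha, b, hb, rfl⟩
  exact convex_convexHull ℝ (A ∪ B) (subset_convexHull ℝ (A ∪ B) (Or.inl ha))
    (subset_convexHull ℝ (A ∪ B) (Or.inr hb)) (sub_nonneg.2 h1) h0 (by ring)

section Face

variable {E : Type*} [AddCommGroup E] [Module ℝ E]

theorem le_of_mem_convexHull {W : Set E} {f : E →ₗ[ℝ] ℝ} {M : ℝ} (hM : ∀ w ∈ W, f w ≤ M) {x : E}
    (hx : x ∈ convexHull ℝ W) : f x ≤ M :=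
  convexHull_min (t := {x | f x ≤ M}) hM (convex_halfSpace_le f.isLinear M) hx

/-- The face of a convex hull in a given direction is the convex hull of the generators in it. -/
theorem mem_convexHull_face {W : Set E} {f : E →ₗ[ℝ] ℝ} {M : ℝ} (hM : ∀ w ∈ W, f w ≤ M) {x : E}
    (hx : x ∈ convexHull ℝ W) (hxM : f x = M) : x ∈ convexHull ℝ {w ∈ W | f w = M} := by
  have hsub : convexHull ℝ W ⊆ {x | f x < M ∨ f x = M ∧ x ∈ convexHull ℝ {w ∈ W | f w = M}} := by
    refine convexHull_min (fun w hw => ?_) ?_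
    · rcases (hM w hw).lt_or_eq with h | h
      · exact Or.inl h
      · exact Or.inr ⟨h, subset_convexHull ℝ _ ⟨hw, h⟩⟩
    · intro y hy z hz s t hs ht hst
      have hfy : f y ≤ M := hy.elim le_of_lt fun h => h.1.le
      have hfz : f z ≤ M := hz.elim le_of_lt fun h => h.1.le
      obtain rfl : t = 1 - s := by linarith
      rcases hs.eq_or_lt with rfl | hs'
      · simpa using hz
      rcases ht.eq_or_lt with h1 | ht'
      · rw [← h1, zero_smul, add_zero]
        obtain rfl : s = 1 := by linarith
        simpa using hy
      rcases hy with hy | ⟨hy, hy'⟩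
      · left
        rw [map_add, map_smul, map_smul, smul_eq_mul, smul_eq_mul]
        nlinarith
      rcases hz with hz | ⟨hz, hz'⟩
      · left
        rw [map_add, map_smul, map_smul, smul_eq_mul, smul_eq_mul]
        nlinarith
      · right
        refine ⟨?_, convex_convexHull ℝ _ hy' hz' hs ht hst⟩
        rw [map_add, map_smul, map_smul, smul_eq_mul, smul_eq_mul, hy, hz]
        ring
  exact ((hsub hx).resolve_left hxM.not_lt).2

/-- A finite set has a generator which is lexicographically maximal on the convex hull. -/
theorem exists_lex_max {V : Finset E} (hV : V.Nonempty) (f g : E →ₗ[ℝ] ℝ) :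
    ∃ a ∈ V, (∀ x ∈ convexHull ℝ (V : Set E), f x ≤ f a) ∧
      ∀ x ∈ convexHull ℝ (V : Set E), f x = f a → g x ≤ g a := by
  classical
  obtain ⟨c, hc, hcmax⟩ := V.exists_max_image f hV
  obtain ⟨a, ha, hamax⟩ := (V.filter fun w => f w = f c).exists_max_image g ⟨c, by simp [hc]⟩
  rw [Finset.mem_filter] at ha
  refine ⟨a, ha.1, ?_, ?_⟩ <;> rw [ha.2]
  · exact fun x hx => le_of_mem_convexHull hcmax hx
  · intro x hx hfx
    refine le_of_mem_convexHull ?_ (mem_convexHull_face hcmax hx hfx)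
    exact fun w hw => hamax w (Finset.mem_filter.2 hw)

end Face

theorem le_of_mem_layer {A B : Set (ℝ × ℝ)} {θ : ℝ} (h0 : 0 ≤ θ) (h1 : θ ≤ 1)
    {f : ℝ × ℝ →ₗ[ℝ] ℝ} {M N : ℝ} (hA : ∀ x ∈ A, f x ≤ M) (hB : ∀ x ∈ B, f x ≤ N) {x : ℝ × ℝ}
    (hx : x ∈ layer A B θ) : f x ≤ (1 - θ) * M + θ * N := by
  obtain ⟨a, ha, b, hb, rfl⟩ := hx
  rw [map_add, map_smul, map_smul, smul_eq_mul, smul_eq_mul]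
  exact add_le_add (mul_le_mul_of_nonneg_left (hA a ha) (sub_nonneg.2 h1))
    (mul_le_mul_of_nonneg_left (hB b hb) h0)

theorem finite_intPoint_mem_layer {V W : Finset (ℤ × ℤ)} {θ : ℝ} (h0 : 0 ≤ θ) (h1 : θ ≤ 1) :
    {z | intPoint z ∈ layer (convexHull ℝ (intPoint '' V)) (convexHull ℝ (intPoint '' W))
      θ}.Finite := by
  refine finite_intPoint_mem_of_isBounded (Bornology.IsBounded.subset ?_
    (layer_subset_convexHull h0 h1))
  rw [isBounded_convexHull, Bornology.isBounded_union, isBounded_convexHull, isBounded_convexHull]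
  exact ⟨(V.finite_toSet.image _).isBounded, (W.finite_toSet.image _).isBounded⟩

/-- If the first of `k` layers between two lattice polytopes is a lattice polytope, then every
linear functional has a lattice point among its maximizers on each layer. -/
theorem exists_intPoint_max_layer {V W : Finset (ℤ × ℤ)} (hV : V.Nonempty) (hW : W.Nonempty)
    {A B : Set (ℝ × ℝ)} (hA : A = convexHull ℝ (intPoint '' V))
    (hB : B = convexHull ℝ (intPoint '' W)) {k : ℕ} (hk : 2 ≤ k)
    (h : layer A B (1 / k) ⊆ convexHull ℝ (intPoint '' {z | intPoint z ∈ layer A B (1 / k)}))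
    {j : ℕ} (hj : j ≤ k) {f₁ f₂ : ℝ} (hnorm : f₁ ^ 2 + f₂ ^ 2 ≠ 0) :
    ∃ z, intPoint z ∈ layer A B (j / k) ∧
      ∀ x ∈ layer A B (j / k), f₁ * x.1 + f₂ * x.2 ≤ f₁ * z.1 + f₂ * z.2 := by
  classical
  have hkR : (2 : ℝ) ≤ k := by exact_mod_cast hk
  have hk0 : (0 : ℝ) < k := by linarith
  have hj0 : (0 : ℝ) ≤ j / k := by positivity
  have hj1 : (j / k : ℝ) ≤ 1 := (div_le_one hk0).2 (by exact_mod_cast hj)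
  have h10 : (0 : ℝ) < 1 / k := by positivity
  have h11 : (1 / k : ℝ) < 1 := (div_lt_one hk0).2 (by linarith)
  obtain ⟨F, hF⟩ : ∃ F : ℝ × ℝ →ₗ[ℝ] ℝ, ∀ y, F y = f₁ * y.1 + f₂ * y.2 :=
    ⟨f₁ • LinearMap.fst ℝ ℝ ℝ + f₂ • LinearMap.snd ℝ ℝ ℝ, fun y => by simp⟩
  obtain ⟨G, hG⟩ : ∃ G : ℝ × ℝ →ₗ[ℝ] ℝ, ∀ y, G y = -f₂ * y.1 + f₁ * y.2 :=
    ⟨-f₂ • LinearMap.fst ℝ ℝ ℝ + f₁ • LinearMap.snd ℝ ℝ ℝ, fun y => by simp⟩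
  -- Ties for `F` are broken by the orthogonal functional `G`, so the maximizer is a single vertex
  -- and the vertices chosen in `A` and `B` are compatible.
  have hlex : ∀ U : Finset (ℤ × ℤ), U.Nonempty → ∃ a : ℤ × ℤ,
      intPoint a ∈ convexHull ℝ (intPoint '' U) ∧
      (∀ x ∈ convexHull ℝ (intPoint '' U), F x ≤ F (intPoint a)) ∧
      ∀ x ∈ convexHull ℝ (intPoint '' U), F x = F (intPoint a) → G x ≤ G (intPoint a) := by
    intro U hU
    obtain ⟨a, ha, h1, h2⟩ := exists_lex_max (hU.image intPoint) F G
    rw [Finset.coe_image] at h1 h2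
    obtain ⟨z, hz, rfl⟩ := Finset.mem_image.1 ha
    exact ⟨z, subset_convexHull ℝ _ ⟨z, hz, rfl⟩, h1, h2⟩
  obtain ⟨a, haA, haF, haG⟩ := hlex V hV
  obtain ⟨b, hbB, hbF, hbG⟩ := hlex W hW
  rw [← hA] at haA haF haG
  rw [← hB] at hbB hbF hbG
  obtain ⟨e, he⟩ : ∃ e, e = (1 - 1 / (k : ℝ)) • intPoint a + (1 / (k : ℝ)) • intPoint b := ⟨_, rfl⟩
  have heF : F e = (1 - 1 / k) * F (intPoint a) + 1 / k * F (intPoint b) := by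
    rw [he, map_add, map_smul, map_smul, smul_eq_mul, smul_eq_mul]
  have heG : G e = (1 - 1 / k) * G (intPoint a) + 1 / k * G (intPoint b) := by
    rw [he, map_add, map_smul, map_smul, smul_eq_mul, smul_eq_mul]
  have hmem := h ⟨_, haA, _, hbB, he⟩
  have hmem2 := mem_convexHull_face (M := F e) (f := F) (fun y hy => by
    obtain ⟨z, hz, rfl⟩ := hy
    rw [heF]
    exact le_of_mem_layer h10.le h11.le haF hbF hz) hmem rfl
  have hmem3 := mem_convexHull_face (M := G e) (f := G) (fun y hy => by
    obtain ⟨⟨z, ⟨a', ha', b', hb', hz⟩, rfl⟩, hyF⟩ := hy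
    rw [hz, heF, map_add, map_smul, map_smul, smul_eq_mul, smul_eq_mul] at hyF
    have h1 := mul_le_mul_of_nonneg_left (haF a' ha') (sub_nonneg.2 h11.le)
    have h2 := mul_le_mul_of_nonneg_left (hbF b' hb') h10.le
    have h3 := haG a' ha' (mul_left_cancel₀ (sub_pos.2 h11).ne' (by linarith))
    have h4 := hbG b' hb' (mul_left_cancel₀ h10.ne' (by linarith))
    rw [hz, heG, map_add, map_smul, map_smul, smul_eq_mul, smul_eq_mul]
    exact add_le_add (mul_le_mul_of_nonneg_left h3 (sub_nonneg.2 h11.le))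
      (mul_le_mul_of_nonneg_left h4 h10.le)) hmem2 rfl
  -- The lexicographic face of the first layer must contain a lattice point. As `F` and `G` together
  -- determine a point, that lattice point is `e`.
  obtain ⟨_, ⟨⟨z, -, rfl⟩, hzF⟩, hzG⟩ := convexHull_nonempty_iff.1 ⟨e, hmem3⟩
  rw [hF, hF] at hzF
  rw [hG, hG] at hzG
  have hze : intPoint z = e := by
    refine Prod.ext ?_ ?_ <;> apply mul_left_cancel₀ hnorm
    · linear_combination f₁ * hzF - f₂ * hzG
    · linear_combination f₂ * hzF + f₁ * hzG
  -- The step `z - a` is integral and equals one `k`-th of `b - a`; repeating it `j` times from `a`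
  -- stays in the lattice.
  have hez : intPoint (a + (j : ℤ) • (z - a)) = (1 - j / k : ℝ) • intPoint a +
      (j / k : ℝ) • intPoint b := by
    have : intPoint (a + (j : ℤ) • (z - a)) = intPoint a + (j : ℝ) • (intPoint z - intPoint a) := by
      refine Prod.ext ?_ ?_ <;> simp
    rw [this, hze, he]
    match_scalars <;> field_simp
    all_goals ring
  refine ⟨_, ⟨_, haA, _, hbB, hez⟩, fun x hx => ?_⟩
  have h1 := le_of_mem_layer hj0 hj1 haF hbF hx
  have h2 := hF (intPoint (a + (j : ℤ) • (z - a)))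
  rw [intPoint_fst, intPoint_snd] at h2
  rw [← hF, ← h2, hez, map_add, map_smul, map_smul, smul_eq_mul, smul_eq_mul]
  exact h1

/-- If the first of `k` layers between two lattice polytopes is a lattice polytope, then so are all
of them. -/
theorem layer_subset_convexHull_intPoint {V W : Finset (ℤ × ℤ)} (hV : V.Nonempty) (hW : W.Nonempty)
    {A B : Set (ℝ × ℝ)} (hA : A = convexHull ℝ (intPoint '' V))
    (hB : B = convexHull ℝ (intPoint '' W)) {k : ℕ} (hk : 2 ≤ k)
    (h : layer A B (1 / k) ⊆ convexHull ℝ (intPoint '' {z | intPoint z ∈ layer A B (1 / k)}))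
    {j : ℕ} (hj : j ≤ k) :
    layer A B (j / k) ⊆ convexHull ℝ (intPoint '' {z | intPoint z ∈ layer A B (j / k)}) := by
  intro x hx
  by_contra hxK
  have hk0 : (0 : ℝ) < k := by exact_mod_cast (by omega : 0 < k)
  have hfin : {z | intPoint z ∈ layer A B (j / k)}.Finite := by
    rw [hA, hB]
    exact finite_intPoint_mem_layer (by positivity) ((div_le_one hk0).2 (by exact_mod_cast hj))
  obtain ⟨f, u, hfK, hfx⟩ := geometric_hahn_banach_closed_point (convex_convexHull ℝ _)
    ((hfin.image intPoint).isCompact_convexHull ℝ).isClosed hxK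
  have hf : ∀ y : ℝ × ℝ, f y = f (1, 0) * y.1 + f (0, 1) * y.2 := by
    intro y
    have : y = y.1 • ((1 : ℝ), (0 : ℝ)) + y.2 • ((0 : ℝ), (1 : ℝ)) := by simp
    nth_rw 1 [this]
    rw [map_add, map_smul, map_smul, smul_eq_mul, smul_eq_mul]
    ring
  have hcon : ∀ z, intPoint z ∈ layer A B (j / k) → f (intPoint z) < f x := fun z hz =>
    (hfK _ (subset_convexHull ℝ _ ⟨z, hz, rfl⟩)).trans hfx
  by_cases hnorm : f (1, 0) ^ 2 + f (0, 1) ^ 2 = 0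
  · have h1 : f (1, 0) = 0 := by nlinarith [sq_nonneg (f (1, 0)), sq_nonneg (f (0, 1))]
    have h2 : f (0, 1) = 0 := by nlinarith [sq_nonneg (f (1, 0)), sq_nonneg (f (0, 1))]
    obtain ⟨z, hz, -⟩ := exists_intPoint_max_layer hV hW hA hB hk h hj (f₁ := 1) (f₂ := 0)
      (by norm_num)
    have := hcon z hz
    rw [hf, hf x, h1, h2] at this
    simp at this
  · obtain ⟨z, hz, hmax⟩ := exists_intPoint_max_layer hV hW hA hB hk h hj hnorm
    have := hcon z hz
    rw [hf, hf x] at this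
    exact this.not_ge (hmax x hx)

/-- A set on which no nonzero linear functional is constant. -/
def IsSpread (K : Set (ℝ × ℝ)) : Prop :=
  ∀ f : ℝ × ℝ →ₗ[ℝ] ℝ, f ≠ 0 → ∃ x ∈ K, ∃ y ∈ K, f x ≠ f y

/-- The determinant with a fixed integral vector as a linear functional. -/
noncomputable def crossLin (d : ℤ × ℤ) : ℝ × ℝ →ₗ[ℝ] ℝ :=
  (d.1 : ℝ) • LinearMap.snd ℝ ℝ ℝ - (d.2 : ℝ) • LinearMap.fst ℝ ℝ ℝ

theorem crossLin_apply (d : ℤ × ℤ) (x : ℝ × ℝ) : crossLin d x = d.1 * x.2 - d.2 * x.1 := by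
  simp [crossLin]

theorem crossLin_intPoint (d z : ℤ × ℤ) : crossLin d (intPoint z) = cross d z := by
  simp [crossLin, cross]

theorem crossLin_ne_zero {d : ℤ × ℤ} (hd : d ≠ 0) : crossLin d ≠ 0 := by
  intro h
  apply hd
  have h1 := crossLin_apply d (0, 1)
  have h2 := crossLin_apply d (1, 0)
  rw [h] at h1 h2
  simp only [LinearMap.zero_apply, mul_one, mul_zero, sub_zero, zero_sub] at h1 h2
  exact Prod.ext (by exact_mod_cast h1.symm) (by
    have : (d.2 : ℝ) = 0 := by linarith
    exact_mod_cast this)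

theorem cross_sub (d x y : ℤ × ℤ) : cross d (x - y) = cross d x - cross d y := by
  simp only [cross, Prod.fst_sub, Prod.snd_sub]
  ring

theorem IsSpread.exists_intPoint_ne {K : Set (ℝ × ℝ)} (hK : IsSpread K)
    (hhull : K ⊆ convexHull ℝ (intPoint '' {z | intPoint z ∈ K})) {f : ℝ × ℝ →ₗ[ℝ] ℝ}
    (hf : f ≠ 0) : ∃ z w, intPoint z ∈ K ∧ intPoint w ∈ K ∧ f (intPoint z) ≠ f (intPoint w) := by
  by_contra! hall
  obtain ⟨x, hx, y, hy, hxy⟩ := hK f hf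
  obtain ⟨_, z, hz, -⟩ := convexHull_nonempty_iff.1 ⟨x, hhull hx⟩
  have key : ∀ x ∈ K, f x = f (intPoint z) := by
    intro x hx
    refine le_antisymm (le_of_mem_convexHull ?_ (hhull hx)) (neg_le_neg_iff.1 ?_)
    · rintro _ ⟨w, hw, rfl⟩
      exact (hall w z hw hz).le
    · refine le_of_mem_convexHull (f := -f) ?_ (hhull hx)
      rintro _ ⟨w, hw, rfl⟩
      exact (neg_inj.2 (hall w z hw hz)).le
  exact hxy ((key x hx).trans (key y hy).symm)

/-- One functional separates two lattice points; the functional vanishing on their difference then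
separates two more, not both of which lie on the line through the first two. -/
theorem IsSpread.isPlanarLatticePolygon {K : Set (ℝ × ℝ)} (hK : IsSpread K) (hconv : Convex ℝ K)
    (hfin : {z | intPoint z ∈ K}.Finite)
    (hhull : K ⊆ convexHull ℝ (intPoint '' {z | intPoint z ∈ K})) : IsPlanarLatticePolygon K := by
  refine ⟨hconv, hfin, hhull, ?_⟩
  obtain ⟨a, b, ha, hb, hab⟩ := hK.exists_intPoint_ne hhull
    (crossLin_ne_zero (d := (1, 0)) (by simp))
  have hne : b - a ≠ 0 := by
    intro h
    rw [sub_eq_zero] at h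
    exact hab (by rw [h])
  obtain ⟨z, w, hz, hw, hzw⟩ := hK.exists_intPoint_ne hhull (crossLin_ne_zero hne)
  rw [crossLin_intPoint, crossLin_intPoint] at hzw
  by_cases h : cross (b - a) (z - a) = 0
  · refine ⟨a, b, w, ha, hb, hw, fun h' => hzw ?_⟩
    rw [cross_sub] at h h'
    exact_mod_cast (by linarith : cross (b - a) z = cross (b - a) w)
  · exact ⟨a, b, z, ha, hb, hz, h⟩

theorem IsSpread.layer {A B : Set (ℝ × ℝ)} (hA : IsSpread A) (hB : IsSpread B) (θ : ℝ) :
    IsSpread (layer A B θ) := by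
  intro f hf
  obtain ⟨x, hx, y, hy, hxy⟩ := hA f hf
  obtain ⟨z, hz, w, hw, hzw⟩ := hB f hf
  by_cases hθ : θ = 0
  · refine ⟨_, ⟨x, hx, z, hz, rfl⟩, _, ⟨y, hy, z, hz, rfl⟩, ?_⟩
    simpa [hθ] using hxy
  · refine ⟨_, ⟨x, hx, z, hz, rfl⟩, _, ⟨x, hx, w, hw, rfl⟩, ?_⟩
    simpa [hθ] using hzw

/-- A lattice polytope with two distinct points on its face in direction `d` contains a translate
of the primitive vector `d` in this face. -/
theorem exists_intPoint_edge {K : Set (ℝ × ℝ)} (hK : Convex ℝ K)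
    (hhull : K ⊆ convexHull ℝ (intPoint '' {z | intPoint z ∈ K})) {d : ℤ × ℤ}
    (hd : IsCoprime d.1 d.2) {M : ℝ} (hM : ∀ x ∈ K, crossLin d x ≤ M) {x y : ℝ × ℝ} (hx : x ∈ K)
    (hy : y ∈ K) (hxM : crossLin d x = M) (hyM : crossLin d y = M) (hxy : x ≠ y) :
    ∃ q, intPoint q ∈ K ∧ intPoint (q + d) ∈ K ∧
      ∀ x, intPoint x ∈ K → cross d (x - q) ≤ 0 := by
  have hM' : ∀ w ∈ intPoint '' {z | intPoint z ∈ K}, crossLin d w ≤ M := by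
    rintro _ ⟨z, hz, rfl⟩
    exact hM _ hz
  have hx' := mem_convexHull_face hM' (hhull hx) hxM
  have hy' := mem_convexHull_face hM' (hhull hy) hyM
  have hnt : ¬{w ∈ intPoint '' {z | intPoint z ∈ K} | crossLin d w = M}.Subsingleton := by
    intro h
    rcases h.eq_empty_or_singleton with h | ⟨a, h⟩ <;> rw [h] at hx' hy'
    · simp at hx'
    · rw [convexHull_singleton] at hx' hy'
      exact hxy (hx'.trans hy'.symm)
  rw [Set.not_subsingleton_iff] at hnt
  obtain ⟨_, ⟨⟨z, hz, rfl⟩, hzM⟩, _, ⟨⟨w, hw, rfl⟩, hwM⟩, hne⟩ := hnt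
  have hzw : z ≠ w := fun h => hne (by rw [h])
  have key : ∀ {z w : ℤ × ℤ} {m : ℤ}, intPoint z ∈ K → intPoint w ∈ K →
      crossLin d (intPoint z) = M → 0 < m → w.1 - z.1 = m * d.1 → w.2 - z.2 = m * d.2 →
      ∃ q, intPoint q ∈ K ∧ intPoint (q + d) ∈ K ∧
        ∀ x, intPoint x ∈ K → cross d (x - q) ≤ 0 := by
    intro z w m hz hw hzM hm h1 h2
    refine ⟨z, hz, ?_, fun x hx => ?_⟩
    · have hmR : (1 : ℝ) ≤ m := by exact_mod_cast hm
      have := hK hz hw (a := 1 - 1 / (m : ℝ)) (b := 1 / m)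
        (sub_nonneg.2 ((div_le_one (by linarith)).2 hmR)) (by positivity) (by ring)
      have h1' : (w.1 : ℝ) = z.1 + m * d.1 := by
        exact_mod_cast (by linarith : w.1 = z.1 + m * d.1)
      have h2' : (w.2 : ℝ) = z.2 + m * d.2 := by
        exact_mod_cast (by linarith : w.2 = z.2 + m * d.2)
      convert this using 1
      refine Prod.ext ?_ ?_ <;> simp [h1', h2'] <;> field_simp <;> ring
    · have := hM _ hx
      rw [← hzM, crossLin_intPoint, crossLin_intPoint] at this
      rw [cross_sub, sub_nonpos]
      exact_mod_cast this
  have hcr : cross d z = cross d w := by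
    rw [← hwM, crossLin_intPoint, crossLin_intPoint] at hzM
    exact_mod_cast hzM
  obtain ⟨r, s, hrs⟩ := hd
  simp only [cross] at hcr
  -- Two lattice points on the face differ by a real multiple of the primitive vector `d`; Bézout
  -- coefficients show that the multiple is an integer.
  obtain ⟨m, hm⟩ : ∃ m, m = r * (w.1 - z.1) + s * (w.2 - z.2) := ⟨_, rfl⟩
  have h1 : w.1 - z.1 = m * d.1 := by
    rw [hm]
    linear_combination -(w.1 - z.1) * hrs + s * hcr
  have h2 : w.2 - z.2 = m * d.2 := by
    rw [hm]
    linear_combination -(w.2 - z.2) * hrs - r * hcr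
  rcases lt_trichotomy m 0 with hm0 | hm0 | hm0
  · exact key (m := -m) hw hz hwM (by linarith) (by linarith) (by linarith)
  · rw [hm0] at h1 h2
    exact absurd (Prod.ext (by linarith) (by linarith)) hzw
  · exact key hz hw hzM hm0 h1 h2

/-- Every edge of a layer persists in the inner layers. -/
theorem edgesPersist_layer {V W : Finset (ℤ × ℤ)} (hV : V.Nonempty) (hW : W.Nonempty)
    {A B : Set (ℝ × ℝ)} (hA : A = convexHull ℝ (intPoint '' V))
    (hB : B = convexHull ℝ (intPoint '' W)) {θ θ' : ℝ} (hθ0 : 0 ≤ θ) (hθ1 : θ ≤ 1) (hθ'0 : 0 < θ')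
    (hθ'1 : θ' < 1)
    (h : layer A B θ ⊆ convexHull ℝ (intPoint '' {z | intPoint z ∈ layer A B θ}))
    (h' : layer A B θ' ⊆ convexHull ℝ (intPoint '' {z | intPoint z ∈ layer A B θ'})) :
    EdgesPersist (layer A B θ) (layer A B θ') := by
  classical
  intro p d hd hp hpd hmax
  have hmaxR : ∀ x ∈ layer A B θ, crossLin d x ≤ crossLin d (intPoint p) := by
    intro x hx
    refine le_of_mem_convexHull ?_ (h hx)
    rintro _ ⟨z, hz, rfl⟩
    have := hmax z hz
    rw [cross_sub, sub_nonpos] at this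
    rw [crossLin_intPoint, crossLin_intPoint]
    exact_mod_cast this
  have hpdR : crossLin d (intPoint (p + d)) = crossLin d (intPoint p) := by
    rw [crossLin_intPoint, crossLin_intPoint]
    simp only [cross, Prod.fst_add, Prod.snd_add]
    push_cast
    ring
  have hlex : ∀ U : Finset (ℤ × ℤ), U.Nonempty → ∃ a ∈ convexHull ℝ (intPoint '' U),
      ∀ x ∈ convexHull ℝ (intPoint '' U), crossLin d x ≤ crossLin d a := by
    intro U hU
    obtain ⟨a, ha, h1, -⟩ := exists_lex_max (hU.image intPoint) (crossLin d) 0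
    rw [Finset.coe_image] at h1
    refine ⟨a, subset_convexHull ℝ _ ?_, h1⟩
    rw [← Finset.coe_image]
    exact ha
  obtain ⟨a₀, ha₀, haM⟩ := hlex V hV
  obtain ⟨b₀, hb₀, hbM⟩ := hlex W hW
  rw [← hA] at ha₀ haM
  rw [← hB] at hb₀ hbM
  have hM' : ∀ x ∈ layer A B θ', crossLin d x ≤
      (1 - θ') * crossLin d a₀ + θ' * crossLin d b₀ := fun x hx =>
    le_of_mem_layer hθ'0.le hθ'1.le haM hbM hx
  have hconv : Convex ℝ (layer A B θ') := by
    rw [hA, hB]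
    exact (convex_convexHull ℝ _).layer (convex_convexHull ℝ _) θ'
  have hface : ∀ {a a' b b' : ℝ × ℝ}, a ∈ A → a' ∈ A → b ∈ B → b' ∈ B →
      crossLin d a = crossLin d a₀ → crossLin d a' = crossLin d a₀ →
      crossLin d b = crossLin d b₀ → crossLin d b' = crossLin d b₀ →
      (1 - θ') • a + θ' • b ≠ (1 - θ') • a' + θ' • b' →
      ∃ q, intPoint q ∈ layer A B θ' ∧ intPoint (q + d) ∈ layer A B θ' ∧
        ∀ x, intPoint x ∈ layer A B θ' → cross d (x - q) ≤ 0 := by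
    intro a a' b b' ha ha' hb hb' h1 h2 h3 h4 hne
    refine exists_intPoint_edge hconv h' hd hM' ⟨a, ha, b, hb, rfl⟩ ⟨a', ha', b', hb', rfl⟩
      ?_ ?_ hne
    · rw [map_add, map_smul, map_smul, smul_eq_mul, smul_eq_mul, h1, h3]
    · rw [map_add, map_smul, map_smul, smul_eq_mul, smul_eq_mul, h2, h4]
  have htop := hmaxR _ ⟨a₀, ha₀, b₀, hb₀, rfl⟩
  have hne : intPoint p ≠ intPoint (p + d) := by
    intro he
    have h1 := intPoint_injective he
    rw [left_eq_add] at h1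
    rw [h1] at hd
    exact not_isCoprime_zero_zero hd
  have hsplit : ∀ {a b : ℝ × ℝ}, a ∈ A → b ∈ B →
      crossLin d (intPoint p) = crossLin d ((1 - θ) • a + θ • b) →
      (θ ≠ 1 → crossLin d a = crossLin d a₀) ∧ (θ ≠ 0 → crossLin d b = crossLin d b₀) := by
    intro a b ha hb hab
    rw [hab, map_add, map_add, map_smul, map_smul, map_smul, map_smul, smul_eq_mul, smul_eq_mul,
      smul_eq_mul, smul_eq_mul] at htop
    have h1 := mul_le_mul_of_nonneg_left (haM a ha) (sub_nonneg.2 hθ1)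
    have h2 := mul_le_mul_of_nonneg_left (hbM b hb) hθ0
    exact ⟨fun hθ => mul_left_cancel₀ (sub_ne_zero.2 (Ne.symm hθ)) (by linarith),
      fun hθ => mul_left_cancel₀ hθ (by linarith)⟩
  obtain ⟨a, ha, b, hb, hab⟩ := hp
  obtain ⟨a', ha', b', hb', hab'⟩ := hpd
  obtain ⟨h1, h2⟩ := hsplit ha hb (by rw [hab])
  obtain ⟨h1', h2'⟩ := hsplit ha' hb' (by rw [← hpdR, hab'])
  -- The distinct maximizers `intPoint p` and `intPoint (p + d)` differ in a summand of nonzero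
  -- weight, so the face of that summand contains two points. Varying these against one fixed
  -- maximizer of the other summand gives two points on the face of the inner layer.
  by_cases hcase : θ = 1 ∨ a = a'
  · have hθ : θ ≠ 0 := by
      rintro rfl
      rcases hcase with h0 | rfl
      · norm_num at h0
      · exact hne (by rw [hab, hab', zero_smul, zero_smul])
    refine hface ha₀ ha₀ hb hb' rfl rfl (h2 hθ) (h2' hθ) fun heq => hne ?_
    have hbb : b = b' := smul_right_injective _ hθ'0.ne' (add_left_cancel heq)
    rw [hab, hab', hbb]
    rcases hcase with rfl | rfl
    · simp
    · rfl
  · push Not at hcase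
    refine hface ha ha' hb₀ hb₀ (h1 hcase.1) (h1' hcase.1) rfl rfl fun heq => hcase.2 ?_
    exact smul_right_injective _ (sub_pos.2 hθ'1).ne' (add_right_cancel heq)

/-! ### From planar slabs to simplices in space -/

/-- The point of `ℝ³` above the point `x` of the plane at height `h`. -/
def lift (x : ℝ × ℝ) (h : ℝ) : Fin 3 → ℝ := ![x.1, x.2, h]

/-- The lattice point of `ℤ³` above the point `z` of `ℤ²` at height `h`. -/
def intLift (z : ℤ × ℤ) (h : ℤ) : Fin 3 → ℤ := ![z.1, z.2, h]

theorem latticePoint_intLift (z : ℤ × ℤ) (h : ℤ) :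
    latticePoint (intLift z h) = lift (intPoint z) h := by
  ext i
  fin_cases i <;> simp [latticePoint, intLift, lift]

theorem exists_unimodularSimplex_of_weights {R : Set (Fin 3 → ℝ)} (hR : Convex ℝ R)
    (v : Fin 4 → Fin 3 → ℤ) (w : Fin 4 → ℝ) (hv : ∀ i, latticePoint (v i) ∈ R) (hw : ∀ i, 0 ≤ w i)
    (hw1 : ∑ i, w i = 1)
    (hdet : IsUnit (Matrix.of fun i j : Fin 3 => v i.succ j - v 0 j).det) :
    ∃ T, IsUnimodularSimplex T ∧ T ⊆ R ∧ ∑ i, w i • latticePoint (v i) ∈ T := by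
  refine ⟨_, ⟨v, hdet, rfl⟩, convexHull_min ?_ hR, ?_⟩
  · rintro _ ⟨i, rfl⟩
    exact hv i
  · exact (convex_convexHull ℝ _).sum_mem (fun i _ => hw i) hw1
      fun i _ => subset_convexHull ℝ _ ⟨i, rfl⟩

/-- The two layers are one unit apart, so the determinant of each kind of tetrahedron is, up to
sign, the planar determinant in `Covered`. -/
theorem Covered.exists_unimodularSimplex {P Q : Set (ℝ × ℝ)} {s t : ℝ} {x : ℝ × ℝ}
    (h : Covered P Q s t x) (hs : 0 ≤ s) (ht : 0 ≤ t) (hst : s + t = 1) {R : Set (Fin 3 → ℝ)}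
    (hR : Convex ℝ R) {j : ℤ} (hP : ∀ z, intPoint z ∈ P → lift (intPoint z) j ∈ R)
    (hQ : ∀ z, intPoint z ∈ Q → lift (intPoint z) (j + 1) ∈ R) :
    ∃ T, IsUnimodularSimplex T ∧ T ⊆ R ∧ lift x (j + t) ∈ T := by
  have hP' : ∀ z, intPoint z ∈ P → latticePoint (intLift z j) ∈ R := fun z hz => by
    rw [latticePoint_intLift]
    exact hP z hz
  have hQ' : ∀ z, intPoint z ∈ Q → latticePoint (intLift z (j + 1)) ∈ R := fun z hz => by
    rw [latticePoint_intLift]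
    push_cast
    exact hQ z hz
  obtain rfl : s = 1 - t := by linarith
  rcases h with ⟨y, q, ⟨a, b, c, ha, hb, hc, hu, r₀, r₁, r₂, hr₀, hr₁, hr₂, hr, rfl⟩, hq, rfl⟩ |
    ⟨p, y, hp, ⟨a, b, c, ha, hb, hc, hu, r₀, r₁, r₂, hr₀, hr₁, hr₂, hr, rfl⟩, rfl⟩ |
    ⟨p, u, q, v, hp, hpu, hq, hqv, hu, l, m, hl, hl1, hm, hm1, rfl⟩
  · obtain ⟨T, hT, hTR, hx⟩ := exists_unimodularSimplex_of_weights hR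
      ![intLift a j, intLift b j, intLift c j, intLift q (j + 1)]
      ![(1 - t) * r₀, (1 - t) * r₁, (1 - t) * r₂, t]
      (by
        intro i
        fin_cases i
        exacts [hP' a ha, hP' b hb, hP' c hc, hQ' q hq])
      (by
        intro i
        fin_cases i
        exacts [mul_nonneg hs hr₀, mul_nonneg hs hr₁, mul_nonneg hs hr₂, ht])
      (by
        simp only [Fin.sum_univ_four, Matrix.cons_val]
        linear_combination (1 - t) * hr)
      (by
        convert hu using 1
        simp [Matrix.det_fin_three, intLift, cross])
    refine ⟨T, hT, hTR, ?_⟩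
    convert hx using 1
    obtain rfl : r₀ = 1 - r₁ - r₂ := by linarith
    ext i
    fin_cases i <;> simp [Fin.sum_univ_four, lift, latticePoint, intLift] <;> ring
  · obtain ⟨T, hT, hTR, hx⟩ := exists_unimodularSimplex_of_weights hR
      ![intLift a (j + 1), intLift b (j + 1), intLift c (j + 1), intLift p j]
      ![t * r₀, t * r₁, t * r₂, 1 - t]
      (by
        intro i
        fin_cases i
        exacts [hQ' a ha, hQ' b hb, hQ' c hc, hP' p hp])
      (by
        intro i
        fin_cases i
        exacts [mul_nonneg ht hr₀, mul_nonneg ht hr₁, mul_nonneg ht hr₂, hs])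
      (by
        simp only [Fin.sum_univ_four, Matrix.cons_val]
        linear_combination t * hr)
      (by
        convert hu.neg using 1
        simp [Matrix.det_fin_three, intLift, cross]
        ring)
    refine ⟨T, hT, hTR, ?_⟩
    convert hx using 1
    obtain rfl : r₀ = 1 - r₁ - r₂ := by linarith
    ext i
    fin_cases i <;> simp [Fin.sum_univ_four, lift, latticePoint, intLift] <;> ring
  · obtain ⟨T, hT, hTR, hx⟩ := exists_unimodularSimplex_of_weights hR
      ![intLift p j, intLift (p + u) j, intLift q (j + 1), intLift (q + v) (j + 1)]
      ![(1 - t) * (1 - l), (1 - t) * l, t * (1 - m), t * m]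
      (by
        intro i
        fin_cases i
        exacts [hP' p hp, hP' _ hpu, hQ' q hq, hQ' _ hqv])
      (by
        intro i
        fin_cases i
        exacts [mul_nonneg hs (sub_nonneg.2 hl1), mul_nonneg hs hl,
          mul_nonneg ht (sub_nonneg.2 hm1), mul_nonneg ht hm])
      (by
        simp only [Fin.sum_univ_four, Matrix.cons_val]
        ring)
      (by
        convert hu.neg using 1
        simp [Matrix.det_fin_three, intLift, cross]
        ring)
    refine ⟨T, hT, hTR, ?_⟩
    convert hx using 1
    ext i
    fin_cases i <;> simp [Fin.sum_univ_four, lift, latticePoint, intLift] <;> ring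

/-- The image of a subset of `Fin 2 → ℝ` in `ℝ × ℝ`. -/
def planeImage (Q : Set (Fin 2 → ℝ)) : Set (ℝ × ℝ) := LinearEquiv.finTwoArrow ℝ ℝ '' Q

theorem IsLatticePolygon.exists_planeImage_eq {Q : Set (Fin 2 → ℝ)} (hQ : IsLatticePolygon Q) :
    ∃ V : Finset (ℤ × ℤ), V.Nonempty ∧ planeImage Q = convexHull ℝ (intPoint '' V) := by
  classical
  obtain ⟨⟨V, hV, rfl⟩, -⟩ := hQ
  refine ⟨V.image fun v => (v 0, v 1), hV.image _, ?_⟩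
  have := (LinearEquiv.finTwoArrow ℝ ℝ).toLinearMap.image_convexHull
    (latticePoint '' (V : Set (Fin 2 → ℤ)))
  rw [planeImage]
  refine this.trans ?_
  rw [Finset.coe_image, Set.image_image, Set.image_image]
  rfl

/-- A functional constant on the polygon vanishes on its direction space, which is the whole plane.
-/
theorem IsLatticePolygon.isSpread {Q : Set (Fin 2 → ℝ)} (hQ : IsLatticePolygon Q) :
    IsSpread (planeImage Q) := by
  intro f hf
  by_contra! hall
  have htop : vectorSpan ℝ Q = ⊤ := Submodule.eq_top_of_finrank_eq (by rw [hQ.2]; simp)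
  have hle : vectorSpan ℝ Q ≤
      LinearMap.ker (f ∘ₗ (LinearEquiv.finTwoArrow ℝ ℝ).toLinearMap) := by
    rw [vectorSpan_def, Submodule.span_le]
    rintro _ ⟨x, hx, y, hy, rfl⟩
    have := hall _ ⟨x, hx, rfl⟩ _ ⟨y, hy, rfl⟩
    rw [SetLike.mem_coe, LinearMap.mem_ker]
    change (f ∘ₗ (LinearEquiv.finTwoArrow ℝ ℝ).toLinearMap) (x - y) = 0
    rw [map_sub, sub_eq_zero]
    exact this
  rw [htop, top_le_iff, LinearMap.ker_eq_top] at hle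
  apply hf
  ext
  · have := LinearMap.congr_fun hle ![1, 0]
    simpa using this
  · have := LinearMap.congr_fun hle ![0, 1]
    simpa using this

theorem convex_atHeight {Q : Set (Fin 2 → ℝ)} (hQ : Convex ℝ Q) (h : ℝ) :
    Convex ℝ (atHeight Q h) := by
  rintro _ ⟨x, hx, rfl⟩ _ ⟨y, hy, rfl⟩ s t hs ht hst
  refine ⟨_, hQ hx hy hs ht hst, ?_⟩
  ext i
  fin_cases i <;> simp
  rw [← add_mul, hst, one_mul]

/-- The horizontal sections of a prismatoid. -/
theorem lift_mem_prismatoid {Q₁ Q₂ : Set (Fin 2 → ℝ)} {k : ℕ} (hk : 0 < k) (h₁ : Convex ℝ Q₁)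
    (h₂ : Convex ℝ Q₂) (hne₁ : Q₁.Nonempty) (hne₂ : Q₂.Nonempty) {x : ℝ × ℝ} {h : ℝ} :
    lift x h ∈ prismatoid Q₁ Q₂ k ↔
      0 ≤ h ∧ h ≤ k ∧ x ∈ layer (planeImage Q₁) (planeImage Q₂) (h / k) := by
  have hkR : (0 : ℝ) < k := by exact_mod_cast hk
  rw [prismatoid, (convex_atHeight h₁ 0).convexHull_union (convex_atHeight h₂ _)
    (hne₁.image _) (hne₂.image _), mem_convexJoin]
  constructor
  · rintro ⟨_, ⟨a, ha, rfl⟩, _, ⟨b, hb, rfl⟩, s, t, hs, ht, hst, heq⟩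
    have e0 := congrFun heq 0
    have e1 := congrFun heq 1
    have e2 := congrFun heq 2
    simp [lift] at e0 e1 e2
    refine ⟨by rw [← e2]; positivity, by rw [← e2]; nlinarith, _, ⟨a, ha, rfl⟩, _, ⟨b, hb, rfl⟩, ?_⟩
    rw [← e2, mul_div_cancel_right₀ _ hkR.ne']
    obtain rfl : s = 1 - t := by linarith
    refine Prod.ext ?_ ?_ <;> simp
    · exact e0.symm
    · exact e1.symm
  · rintro ⟨h0, hhk, _, ⟨a, ha, rfl⟩, _, ⟨b, hb, rfl⟩, rfl⟩
    refine ⟨_, ⟨a, ha, rfl⟩, _, ⟨b, hb, rfl⟩, 1 - h / k, h / k,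
      sub_nonneg.2 ((div_le_one hkR).2 hhk), by positivity, by ring, ?_⟩
    ext i
    fin_cases i <;> simp [lift]
    rw [div_mul_cancel₀ _ hkR.ne']

theorem mainTheorem4 (Q₁ Q₂ : Set (Fin 2 → ℝ)) (k : ℕ) (hk : 2 ≤ k)
    (hQ₁ : IsLatticePolygon Q₁) (hQ₂ : IsLatticePolygon Q₂)
    (hslice : IsLatticePolygon (prismatoid Q₁ Q₂ k ∩ {x : Fin 3 → ℝ | x 2 = 1})) :
    HasUnimodularCover (prismatoid Q₁ Q₂ k) := by
  have hkR : (2 : ℝ) ≤ k := by exact_mod_cast hk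
  have hk0 : (0 : ℝ) < k := by linarith
  have hconv : ∀ {Q : Set (Fin 2 → ℝ)}, IsLatticePolygon Q → Convex ℝ Q ∧ Q.Nonempty := by
    rintro _ ⟨⟨V, hV, rfl⟩, -⟩
    exact ⟨convex_convexHull ℝ _, ((Finset.coe_nonempty.2 hV).image _).convexHull⟩
  have hlift : ∀ {x : ℝ × ℝ} {h : ℝ}, lift x h ∈ prismatoid Q₁ Q₂ k ↔
      0 ≤ h ∧ h ≤ k ∧ x ∈ layer (planeImage Q₁) (planeImage Q₂) (h / k) :=
    lift_mem_prismatoid (by omega) (hconv hQ₁).1 (hconv hQ₂).1 (hconv hQ₁).2 (hconv hQ₂).2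
  obtain ⟨V, hV, hA⟩ := hQ₁.exists_planeImage_eq
  obtain ⟨W, hW, hB⟩ := hQ₂.exists_planeImage_eq
  have hsA := hQ₁.isSpread
  have hsB := hQ₂.isSpread
  set A := planeImage Q₁
  set B := planeImage Q₂
  have hfirst : layer A B (1 / k) ⊆
      convexHull ℝ (intPoint '' {z | intPoint z ∈ layer A B (1 / k)}) := by
    obtain ⟨⟨U, -, hU⟩, -⟩ := hslice
    intro y hy
    have hy' : lift y 1 ∈ prismatoid Q₁ Q₂ k ∩ {x : Fin 3 → ℝ | x 2 = 1} :=
      ⟨hlift.2 ⟨zero_le_one, by linarith, hy⟩, rfl⟩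
    rw [hU] at hy'
    let π : (Fin 3 → ℝ) →ₗ[ℝ] ℝ × ℝ := (LinearMap.proj 0).prod (LinearMap.proj 1)
    have h1 : π (lift y 1) ∈ π '' convexHull ℝ (latticePoint '' (U : Set (Fin 3 → ℤ))) :=
      ⟨_, hy', rfl⟩
    rw [π.image_convexHull] at h1
    refine convexHull_mono ?_ h1
    rintro _ ⟨_, ⟨v, hv, rfl⟩, rfl⟩
    have hv' : latticePoint v ∈ prismatoid Q₁ Q₂ k ∩ {x : Fin 3 → ℝ | x 2 = 1} :=
      hU ▸ subset_convexHull ℝ _ ⟨v, hv, rfl⟩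
    have hveq : latticePoint v = lift (intPoint (v 0, v 1)) 1 := by
      ext i
      fin_cases i
      exacts [rfl, rfl, hv'.2]
    exact ⟨(v 0, v 1), (hlift.1 (hveq ▸ hv'.1)).2.2, rfl⟩
  have hhull : ∀ j : ℕ, j ≤ k → layer A B (j / k) ⊆
      convexHull ℝ (intPoint '' {z | intPoint z ∈ layer A B (j / k)}) := fun j hj =>
    layer_subset_convexHull_intPoint hV hW hA hB hk hfirst hj
  have hθ : ∀ j : ℕ, j ≤ k → 0 ≤ (j / k : ℝ) ∧ (j / k : ℝ) ≤ 1 := fun j hj =>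
    ⟨by positivity, (div_le_one hk0).2 (by exact_mod_cast hj)⟩
  have hpoly : ∀ j : ℕ, j ≤ k → IsPlanarLatticePolygon (layer A B (j / k)) := fun j hj => by
    refine (hsA.layer hsB _).isPlanarLatticePolygon ?_ ?_ (hhull j hj)
    · rw [hA, hB]
      exact (convex_convexHull ℝ _).layer (convex_convexHull ℝ _) _
    · rw [hA, hB]
      exact finite_intPoint_mem_layer (hθ j hj).1 (hθ j hj).2
  have hpersist : ∀ i j : ℕ, i ≤ k → 0 < j → j < k →
      EdgesPersist (layer A B (i / k)) (layer A B (j / k)) := fun i j hi hj hjk =>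
    edgesPersist_layer hV hW hA hB (hθ i hi).1 (hθ i hi).2
      (div_pos (by exact_mod_cast hj) hk0) ((div_lt_one hk0).2 (by exact_mod_cast hjk))
      (hhull i hi) (hhull j hjk.le)
  -- The cover consists of all unimodular simplices inside the prismatoid, so only the existence of
  -- one through each point is at stake.
  refine ⟨{T | IsUnimodularSimplex T ∧ T ⊆ prismatoid Q₁ Q₂ k}, fun T hT => hT.1,
    Set.Subset.antisymm (Set.sUnion_subset fun T hT => hT.2) fun x hx => ?_⟩
  have hx' : x = lift (x 0, x 1) (x 2) := by
    ext i
    fin_cases i <;> rfl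
  rw [hx'] at hx
  obtain ⟨h0, hhk, a, ha, b, hb, hab⟩ := hlift.1 hx
  -- The floor of the height, except at the top `x 2 = k`, which belongs to the slab starting at `k
  -- - 1`.
  obtain ⟨j, hjk, hj, hj1⟩ : ∃ j : ℕ, j + 1 ≤ k ∧ (j : ℝ) ≤ x 2 ∧ x 2 ≤ j + 1 := by
    by_cases hlt : x 2 < k
    · have := (Nat.floor_lt h0).2 hlt
      exact ⟨⌊x 2⌋₊, this, Nat.floor_le h0, (Nat.lt_floor_add_one _).le⟩
    · refine ⟨k - 1, by omega, ?_, ?_⟩ <;> rw [Nat.cast_sub (by omega)] <;> push_cast <;> linarith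
  have ht : 0 ≤ x 2 - j := sub_nonneg.2 hj
  have hs : 0 ≤ 1 - (x 2 - j) := by linarith
  have hp : (1 - (j / k : ℝ)) • a + (j / k : ℝ) • b ∈ layer A B (j / k) := ⟨a, ha, b, hb, rfl⟩
  have hq : (1 - (((j + 1 : ℕ) : ℝ) / k)) • a + (((j + 1 : ℕ) : ℝ) / k) • b ∈
      layer A B ((j + 1 : ℕ) / k) := ⟨a, ha, b, hb, rfl⟩
  have hcov : Covered (layer A B (j / k)) (layer A B ((j + 1 : ℕ) / k)) (1 - (x 2 - j)) (x 2 - j)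
      (x 0, x 1) := by
    have hsum : (x 0, x 1) = (1 - (x 2 - j)) • ((1 - (j / k : ℝ)) • a + (j / k : ℝ) • b) +
        (x 2 - j) • ((1 - (((j + 1 : ℕ) : ℝ) / k)) • a + (((j + 1 : ℕ) : ℝ) / k) • b) := by
      rw [hab]
      push_cast
      match_scalars <;> field_simp <;> ring
    rw [hsum]
    -- Edges persist only into an inner layer. The upper layer is inner unless `j + 1 = k`; then `j
    -- ≥ 1` because `k ≥ 2`, and the slab is read upside down.
    rcases Nat.lt_or_ge (j + 1) k with hlt | hge
    · exact covered_of_edgesPersist (hpoly j (by omega)) (hpoly (j + 1) hjk)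
        (hpersist j (j + 1) (by omega) (by omega) hlt) hs ht (by ring) hp hq
    · rw [add_comm ((1 - (x 2 - j)) • _)]
      exact (covered_of_edgesPersist (hpoly (j + 1) hjk) (hpoly j (by omega))
        (hpersist (j + 1) j hjk (by omega) (by omega)) ht hs (by ring) hq hp).symm
  obtain ⟨T, hT, hTR, hxT⟩ := hcov.exists_unimodularSimplex hs ht (by ring) (j := j)
    (R := prismatoid Q₁ Q₂ k) (convex_convexHull ℝ _)
    (fun z hz => hlift.2 ⟨by positivity, by exact_mod_cast (by omega : j ≤ k),
      by rwa [Int.cast_natCast]⟩)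
    (fun z hz => hlift.2 ⟨by positivity, by exact_mod_cast hjk,
      by push_cast at hz ⊢; exact hz⟩)
  refine ⟨T, ⟨hT, hTR⟩, ?_⟩
  rw [hx']
  convert hxT using 2
  push_cast
  ring
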